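/- Let $a,b\ge 2$ be integers and let $\Gamma=(V,E)$ be the graph $\Gamma(a,b)$, i.e. the infinite graph in which precisely $a$ copies of the complete graph $C_b$ on $b$ vertices are tacked together at each vertex in a tree-like way: $V$ carries a family of $b$-element subsets (the copies of $C_b$), each vertex lies in precisely $a$ of them, two distinct vertices are adjacent iff they lie in a common copy, and the bipartite incidence graph of vertices and copies is a tree. Let $d$ be the graph distance. Then $\Gamma$ is distance-regular, i.e. it is connected and locally finite, and for $x,y\in V$ with $d(x,y)=k$ the number $$p_{i,j}^k:=|\{z\in V:\ d(x,z)=i,\ d(y,z)=j\}|$$ depends only on $i,j,k$; moreover, every $k\in X:=\mathbb N_0$ occurs as a distance. Put $\omega_k:=p_{k,k}^0$, and for $i,j\in X$ and $f:X\to\mathbb C$ put $$f(i*j):=\sum_{k=|i-j|}^{i+j}\frac{\omega_k}{\omega_i\omega_j}\,p_{i,j}^k\,f(k),$$ which is the integral of $f$ with respect to the convolution $\delta_i*\delta_j$ of the polynomial hypergroup $(X,*)$ associated with $\Gamma$; the involution of this hypergroup is the identity. A function $f$ is called positive definite on $(X,*)$ if $\sum_{k,l=1}^n c_k\overline{c_l}\,f(x_k*x_l)\ge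 0$ for all $n$, all $x_1,\dots,x_n\in X$ and all $c_1,\dots,c_n\in\mathbb C$. A kernel $Q:V\times V\to\mathbb R$ is called positive semidefinite if $\sum_{i,j=1}^n c_i\overline{c_j}\,Q(u_i,u_j)\ge 0$ for all $n$, all $u_1,\dots,u_n\in V$ and all $c_1,\dots,c_n\in\mathbb C$. With these notions, the following statements are equivalent: 1. $a=2$ or $b=2$; 2. for every bounded function $f:X\to\mathbb R$ that is positive definite on $(X,*)$, the kernel $Q_f:V\times V\to\mathbb R$, $Q_f(u,v):=f(d(u,v))$, is positive semidefinite. -/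

import Mathlib

open scoped ComplexOrder

universe u

/-- The bipartite incidence graph of a family `C` of subsets of `V`: a point `v` is joined to
an index `i` exactly when `v ∈ C i`, and there are no other edges. -/
def incidenceGraph {V ι : Type*} (C : ι → Set V) : SimpleGraph (V ⊕ ι) where
  Adj x y :=
    match x, y with
    | .inl v, .inr i => v ∈ C i
    | .inr i, .inl v => v ∈ C i
    | _, _ => False
  symm := ⟨by rintro (v | i) (w | j) h <;> exact h⟩
  loopless := ⟨by rintro (v | i) h <;> exact h⟩

/-- `IsGamma a b G` says that `G` is (a copy of) the graph `Γ(a, b)`: it is made of copies `C i`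
of the complete graph with `b` vertices, precisely `a` of which are tacked together at each
vertex, in a tree-like way (the incidence graph of vertices and copies is a tree). -/
def IsGamma (a b : ℕ) {V : Type u} (G : SimpleGraph V) : Prop :=
  ∃ (ι : Type u) (C : ι → Set V),
    (∀ i, (C i).ncard = b) ∧
    (∀ v, {i | v ∈ C i}.ncard = a) ∧
    (∀ v w, G.Adj v w ↔ v ≠ w ∧ ∃ i, v ∈ C i ∧ w ∈ C i) ∧
    (incidenceGraph C).IsTree

/-- A graph in which every vertex other than `r` has exactly one neighbour (its parent) of at most
the same level, the parent having smaller level, is a tree. -/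
theorem isTree_of_parent {W : Type*} (T : SimpleGraph W) (lev : W → ℕ) (par : W → W) (r : W)
    (h1 : ∀ w, w ≠ r → T.Adj w (par w) ∧ lev (par w) < lev w)
    (h2 : ∀ x y, T.Adj x y → lev y ≤ lev x → y = par x) : T.IsTree := by
  have hr : ∀ n w, lev w = n → T.Reachable w r := by
    intro n
    induction n using Nat.strong_induction_on with
    | _ n ih =>
      intro w hw
      by_cases hwr : w = r
      · subst hwr; exact SimpleGraph.Reachable.refl _
      · obtain ⟨ha, hl⟩ := h1 w hwr
        exact ha.reachable.trans (ih _ (hw ▸ hl) _ rfl)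
  have : Nonempty W := ⟨r⟩
  refine ⟨⟨fun x y => (hr _ x rfl).trans (hr _ y rfl).symm⟩, ?_⟩
  intro v c hc
  classical
  obtain ⟨m, hm, hmax⟩ := c.support.toFinset.exists_max_image lev ⟨v, by simp⟩
  have hm' : m ∈ c.support := by simpa using hm
  have hc' := hc.rotate hm'
  have hs : ∀ x ∈ (c.rotate m hm').support, lev x ≤ lev m := by
    intro x hx
    refine hmax x ?_
    have : x ∈ c.support := by
      simpa using hx
    simpa using this
  have e1 := h2 m _ ((c.rotate m hm').adj_snd hc'.not_nil) (hs _ (SimpleGraph.Walk.getVert_mem_support _ _))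
  have e2 := h2 m _ ((c.rotate m hm').adj_penultimate hc'.not_nil).symm (hs _ (SimpleGraph.Walk.getVert_mem_support _ _))
  exact hc'.snd_ne_penultimate (e1.trans e2.symm)

/-- The graph `Γ(a, b)` exists: its vertices are the reduced words of the free product of `a`
cyclic groups of order `b`. -/
theorem exists_isGamma (a b : ℕ) (hb : 2 ≤ b) :
    ∃ (V : Type) (G : SimpleGraph V), IsGamma a b G := by
  obtain ⟨b, rfl⟩ : ∃ c, b = c + 1 := ⟨b - 1, by omega⟩
  let V := {l : List (Fin a × Fin b) // l.IsChain (fun p q => p.1 ≠ q.1)}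
  let ι := {p : V × Fin a // ∀ q ∈ p.1.1.head?, p.2 ≠ q.1}
  let ext : ι → Fin b → V := fun p h => ⟨(p.1.2, h) :: p.1.1.1, by
    rw [List.isChain_cons]; exact ⟨fun q hq => p.2 q hq, p.1.1.2⟩⟩
  let C : ι → Set V := fun p => Set.range (fun o : Option (Fin b) => o.elim p.1.1 (ext p))
  have hextinj : ∀ p, Function.Injective (fun o : Option (Fin b) => o.elim p.1.1 (ext p)) := by
    rintro p (_ | x) (_ | y) h
    · rfl
    · have := congrArg (fun v : V => v.1.length) h
      simp [ext] at this
    · have := congrArg (fun v : V => v.1.length) h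
      simp [ext] at this
    · have := congrArg (fun v : V => v.1) h
      simpa [ext] using this
  have hpar : ∀ v : V, v.1 ≠ [] → ∃ p : ι, ∃ h, v = ext p h := by
    rintro ⟨_ | ⟨⟨i, h⟩, t⟩, hl⟩ hne
    · exact absurd rfl hne
    ·
      rw [List.isChain_cons] at hl
      exact ⟨⟨⟨⟨t, hl.2⟩, i⟩, fun q hq => hl.1 q hq⟩, h, rfl⟩
  have hextp : ∀ p q h k, ext p h = ext q k → p = q := by
    intro p q h k e
    have := congrArg (fun v : V => v.1) e
    simp only [ext, List.cons.injEq, Prod.mk.injEq] at this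
    exact Subtype.ext (Prod.ext (Subtype.ext this.2) this.1.1)
  have hmem : ∀ v p, v ∈ C p ↔ v = p.1.1 ∨ ∃ h, v = ext p h := by
    intro v p
    constructor
    · rintro ⟨_ | h, e⟩
      · exact Or.inl e.symm
      · exact Or.inr ⟨h, e.symm⟩
    · rintro (e | ⟨h, e⟩)
      · exact ⟨none, e.symm⟩
      · exact ⟨some h, e.symm⟩
  let G : SimpleGraph V :=
    { Adj := fun v w => v ≠ w ∧ ∃ i, v ∈ C i ∧ w ∈ C i
      symm := ⟨fun v w h => ⟨h.1.symm, h.2.imp fun _ h => h.symm⟩⟩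
      loopless := ⟨fun v h => h.1 rfl⟩ }
  refine ⟨V, G, ι, C, ?_, ?_, fun v w => Iff.rfl, ?_⟩
  · intro p
    rw [← Nat.card_coe_set_eq, Nat.card_range_of_injective (hextinj p)]
    simp
  · intro v
    have : Set.BijOn (fun p : ι => p.1.2) {i | v ∈ C i} Set.univ := by
      refine ⟨fun _ _ => trivial, ?_, ?_⟩
      · intro p hp q hq e
        simp only [Set.mem_ofPred_eq, hmem] at hp hq
        rcases hp with hp | ⟨h, hp⟩ <;> rcases hq with hq | ⟨k, hq⟩
        · exact Subtype.ext (Prod.ext (hp.symm.trans hq) e)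
        · exfalso
          refine p.2 (q.1.2, k) ?_ e
          rw [← hp, hq]; rfl
        · exfalso
          refine q.2 (p.1.2, h) ?_ e.symm
          rw [← hq, hp]; rfl
        · exact hextp p q h k (hp.symm.trans hq)
      · intro i _
        by_cases hi : ∀ q ∈ v.1.head?, i ≠ q.1
        · exact ⟨⟨(v, i), hi⟩, (hmem _ _).2 (Or.inl rfl), rfl⟩
        · push Not at hi
          obtain ⟨q, hq, rfl⟩ := hi
          obtain ⟨p, h, rfl⟩ := hpar v (by rintro e; rw [e] at hq; simp at hq)
          refine ⟨p, (hmem _ _).2 (Or.inr ⟨h, rfl⟩), ?_⟩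
          simp [ext] at hq
          simp [← hq]
    rw [this.ncard_eq]
    simp [Set.ncard_univ]
  · classical
    refine isTree_of_parent _
      (Sum.elim (fun v => 2 * v.1.length) (fun p => 2 * p.1.1.1.length + 1))
      (Sum.elim (fun v => if h : v.1 ≠ [] then Sum.inr (hpar v h).choose else Sum.inl v)
        (fun p => Sum.inl p.1.1)) (Sum.inl ⟨[], by simp⟩) ?_ ?_
    · rintro (v | p) h
      · have hv : v.1 ≠ [] := fun e => h (congrArg Sum.inl (Subtype.ext e))
        obtain ⟨k, hk⟩ := (hpar v hv).choose_spec
        simp only [Sum.elim_inl, dif_pos hv]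
        refine ⟨(hmem _ _).2 (Or.inr ⟨k, hk⟩), ?_⟩
        have := congrArg (fun v : V => v.1.length) hk
        simp only [ext, List.length_cons] at this
        simp only [Sum.elim_inr]; omega
      · exact ⟨(hmem _ _).2 (Or.inl rfl), by simp⟩
    · rintro (v | p) (w | q) h hl
      · exact h.elim
      · replace h := (hmem _ _).1 h
        rcases h with h | ⟨k, h⟩
        · subst h; simp at hl
        · have hv : v.1 ≠ [] := by rw [h]; simp [ext]
          obtain ⟨m, hm⟩ := (hpar v hv).choose_spec
          simp only [Sum.elim_inl, dif_pos hv]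
          exact congrArg Sum.inr (hextp _ _ _ _ (h.symm.trans hm))
      · replace h := (hmem _ _).1 h
        rcases h with h | ⟨k, h⟩
        · simp [h]
        · subst h; simp [ext] at hl; omega
      · exact h.elim

/-- Number of vertices `z` with `d(x, z) = i` and `d(y, z) = j`. -/
noncomputable def sphereInterCard {V : Type*} (G : SimpleGraph V) (x y : V) (i j : ℕ) : ℕ :=
  {z | G.dist x z = i ∧ G.dist y z = j}.ncard

/-- Distance-regular graphs: connected, locally finite, and the number of `z` with
`d(x, z) = i` and `d(y, z) = j` depends only on `i`, `j` and `d(x, y)`. -/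
def IsDistanceRegular {V : Type*} (G : SimpleGraph V) : Prop :=
  G.Connected ∧ (∀ v, (G.neighborSet v).Finite) ∧
    ∀ (i j : ℕ) (x y x' y' : V), G.dist x y = G.dist x' y' →
      sphereInterCard G x y i j = sphereInterCard G x' y' i j

open Classical in
/-- The intersection number `p i j k` of a distance-regular graph, computed at some pair of
vertices at distance `k`. -/
noncomputable def intersectionNumber {V : Type*} (G : SimpleGraph V) (i j k : ℕ) : ℕ :=
  if h : ∃ p : V × V, G.dist p.1 p.2 = k then
    sphereInterCard G h.choose.1 h.choose.2 i j
  else 0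

/-- The number `ω k = p k k 0` of vertices at distance `k` from a fixed vertex. -/
noncomputable def sphereCard {V : Type*} (G : SimpleGraph V) (k : ℕ) : ℕ :=
  intersectionNumber G k k 0

/-- The mass `ω k / (ω i * ω j) * p i j k` which the probability measure `δ_i * δ_j` of the
polynomial hypergroup of a distance-regular graph gives to `k`. -/
noncomputable def convWeight {V : Type*} (G : SimpleGraph V) (i j k : ℕ) : ℝ :=
  (sphereCard G k : ℝ) / ((sphereCard G i : ℝ) * (sphereCard G j : ℝ)) *
    (intersectionNumber G i j k : ℝ)

/-- The value `f(i * j) = ∑ k, f k * (δ_i * δ_j)({k})` for the polynomial hypergroup on `ℕ` of a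
distance-regular graph of infinite diameter; `δ_i * δ_j` lives on `|i - j|, …, i + j`. -/
noncomputable def convApply {V : Type*} (G : SimpleGraph V) (f : ℕ → ℂ) (i j : ℕ) : ℂ :=
  ∑ k ∈ Finset.Icc (max i j - min i j) (i + j), f k * (convWeight G i j k : ℂ)

/-- `f` is positive definite on the polynomial hypergroup of `G`:
`∑ k, ∑ l, c k * conj (c l) * f (x k * x l)` is real and nonnegative for all finite families of
points `x k` and complex numbers `c k`. The hypergroup is symmetric, so its involution is the
identity. -/
def IsPosDefOnHypergroup {V : Type*} (G : SimpleGraph V) (f : ℕ → ℂ) : Prop :=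
  ∀ (n : ℕ) (x : Fin n → ℕ) (c : Fin n → ℂ),
    0 ≤ ∑ k, ∑ l, c k * (starRingEnd ℂ) (c l) * convApply G f (x k) (x l)

/-- The kernel `Q` is positive semidefinite: `∑ i, ∑ j, c i * conj (c j) * Q (x i) (x j)` is real
and nonnegative for all finite families of points `x i` and complex numbers `c i`. -/
def IsPosSemidefKernel {S : Type*} (Q : S → S → ℂ) : Prop :=
  ∀ (n : ℕ) (x : Fin n → S) (c : Fin n → ℂ),
    0 ≤ ∑ i, ∑ j, c i * (starRingEnd ℂ) (c j) * Q (x i) (x j)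

/-! Write `P n` for `gammaPoly a b n`. Summing `P (d(u,·))` over the neighbours of `v` multiplies `P
(d(u,v))` by `a(b-1)X`; hence `P i * P j` expands into the `P k` with the weights of `δ_i * δ_j`.
Because `P n` has degree `n`, a function `f` on the hypergroup is the same as a linear functional
`L` on `ℝ[X]` with `L (P n) = f n`, and positive definiteness of `f` gives `0 ≤ L (p²)`.

If `f` is bounded, Cauchy-Schwarz yields `|L (P k)| ≤ L 1`. This also applies to `q ↦ L (p² q)`, so
`L` is nonnegative on `(1 - P k) p²`. For `b = 2` the same bound makes `L` nonnegative on `(1 +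
(b-1)X) p²`; for `a = 2` this needs a spectral radius estimate (`functional_one_add_nonneg`).

The kernel is then studied through the `ℝ[X]`-valued Gram form `P (d(u,v))` on finitely supported
coefficients. Take a deepest vertex `w`, seen from a fixed block, with parent `v` in the block `C
i`. Each child of `v` equals a common mean `M`, a combination of `v` and the other points of `C i`,
plus a noise term orthogonal to `M` and to all non-children in the support. If `a = 2` or `b = 2`,
distinct children of `v` have one common distance `κ`, so the noise contributes `1 - P κ` times a
variance, on which `L` is nonnegative. Replacing children by `M` (`exists_distForm_le`) thus only
decreases the form. Repetition moves the support into one block, whose Gram matrix `(1 - X) I + X J`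
is controlled by the weights `1 - X` and `1 + (b-1)X`.

Conversely, for `a, b ≥ 3` there is a bounded eigenfunction `φ` with `1 + (b-1) φ 1 < 0`. It is
multiplicative, hence positive definite on the hypergroup, but the all-ones vector on a block shows
that its kernel is not positive semidefinite. -/

/-! ### Distances in trees. -/

namespace SimpleGraph.IsTree

variable {W : Type*} {T : SimpleGraph W}

theorem exists_adj_closer (hT : T.IsTree) {r w : W} (h : w ≠ r) :
    ∃ p, T.Adj w p ∧ T.dist r w = T.dist r p + 1 := by
  obtain ⟨p, hp, hl⟩ := hT.connected.exists_path_of_dist r w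
  have hn : ¬ p.Nil := fun hn => h hn.eq.symm
  refine ⟨p.penultimate, (p.adj_penultimate hn).symm, ?_⟩
  have h1 : T.dist r p.penultimate ≤ p.dropLast.length := dist_le _
  have h2 := hT.dist_eq_dist_add_one_of_adj r (p.adj_penultimate hn)
  have h3 : p.dropLast.length + 1 = p.length := by
    simpa using p.length_dropLast_add_one hn
  omega

/-- Geodesics from `r` to `p` and to `q`, each extended by the edge to `w`, are two paths with the
same ends, so they coincide and have the same penultimate vertex. -/
theorem closer_unique (hT : T.IsTree) {r w p q : W} (hp : T.Adj w p) (hq : T.Adj w q)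
    (hdp : T.dist r w = T.dist r p + 1) (hdq : T.dist r w = T.dist r q + 1) : p = q := by
  obtain ⟨P, -, hPl⟩ := hT.connected.exists_path_of_dist r p
  obtain ⟨Q, -, hQl⟩ := hT.connected.exists_path_of_dist r q
  have h1 : (P.concat hp.symm).IsPath :=
    Walk.isPath_of_length_eq_dist _ (by rw [Walk.length_concat]; omega)
  have h2 : (Q.concat hq.symm).IsPath :=
    Walk.isPath_of_length_eq_dist _ (by rw [Walk.length_concat]; omega)
  have h3 := (hT.existsUnique_path r w).unique h1 h2
  simpa using congrArg Walk.penultimate h3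

theorem dist_of_ne_closer (hT : T.IsTree) {r w p q : W} (hp : T.Adj w p) (hq : T.Adj w q)
    (hdp : T.dist r w = T.dist r p + 1) (h : q ≠ p) : T.dist r q = T.dist r w + 1 := by
  rcases hT.dist_eq_dist_add_one_of_adj r hq with h1 | h1
  · exact absurd (hT.closer_unique hq hp h1 hdp) h
  · exact h1

/-- If the edge `iv` separates `r` from `u`, then `v` lies between `r` and `u`. -/
theorem dist_eq_add_of_separates (hT : T.IsTree) {r i v : W} (hiv : T.Adj v i)
    (hr : T.dist r v = T.dist r i + 1) :
    ∀ u, T.dist i u = T.dist v u + 1 → T.dist r u = T.dist r v + T.dist v u := by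
  have key : ∀ n u, T.dist v u = n → T.dist i u = n + 1 → T.dist r u = T.dist r v + n := by
    intro n
    induction n using Nat.strong_induction_on with
    | _ n ih =>
      intro u hvu hiu
      by_cases huv : u = v
      · subst huv; simp at hvu; omega
      obtain ⟨u', hu', hd'⟩ := hT.exists_adj_closer huv
      have hi1 := hT.dist_eq_dist_add_one_of_adj i hu'
      have hi2 := hT.dist_eq_dist_add_one_of_adj u' hiv
      rw [dist_comm (u := u') (v := v), dist_comm (u := u') (v := i)] at hi2
      have h1 := ih (n - 1) (by omega) u' (by omega) (by omega)
      rcases hT.dist_eq_dist_add_one_of_adj r hu' with h | h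
      · omega
      -- Here `u` would be the neighbour of `u'` closer to `r`. That neighbour is `i` when `u' = v`,
      -- and otherwise the next vertex `u''` towards `v`; both contradict the distances of `u`.
      exfalso
      by_cases huv' : u' = v
      · subst huv'
        have := hT.closer_unique hiv hu'.symm hr h
        subst this
        simp at hiu
      · obtain ⟨u'', hu'', hd''⟩ := hT.exists_adj_closer huv'
        have hi3 := hT.dist_eq_dist_add_one_of_adj i hu''
        have hi4 := hT.dist_eq_dist_add_one_of_adj u'' hiv
        rw [dist_comm (u := u'') (v := v), dist_comm (u := u'') (v := i)] at hi4
        have h2 := ih (n - 2) (by omega) u'' (by omega) (by omega)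
        have := hT.closer_unique hu'.symm hu'' h (by omega)
        subst this
        omega
  exact fun u hu => key _ u rfl hu

end SimpleGraph.IsTree

/-! ### Distances and blocks in the graph. -/

/-- The blocks `C i` exhibit `G` as a copy of the graph `Γ(a, b)`. -/
structure IsGammaBlocks (a b : ℕ) {V ι : Type*} (G : SimpleGraph V) (C : ι → Set V) : Prop where
  ncard_block : ∀ i, (C i).ncard = b
  ncard_at : ∀ v, {i | v ∈ C i}.ncard = a
  adj_iff : ∀ v w, G.Adj v w ↔ v ≠ w ∧ ∃ i, v ∈ C i ∧ w ∈ C i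
  isTree : (incidenceGraph C).IsTree

namespace IsGammaBlocks

variable {a b : ℕ} {V ι : Type*} {G : SimpleGraph V} {C : ι → Set V}

theorem adj_inl (v : V) (x : V ⊕ ι) :
    (incidenceGraph C).Adj (.inl v) x ↔ ∃ i, x = .inr i ∧ v ∈ C i := by
  rcases x with w | i
  · simp [incidenceGraph]
  · simp [incidenceGraph]

theorem adj_inr (i : ι) (x : V ⊕ ι) :
    (incidenceGraph C).Adj (.inr i) x ↔ ∃ v, x = .inl v ∧ v ∈ C i := by
  rcases x with w | i
  · simp [incidenceGraph]
  · simp [incidenceGraph]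

theorem adj_mk {v : V} {i : ι} (h : v ∈ C i) : (incidenceGraph C).Adj (.inl v) (.inr i) := h

/-- Two tree edges towards `x` lead from a point through a block to another point of that block,
which is one edge of `G`. -/
theorem exists_walk (h : IsGammaBlocks a b G C) (x : V) : ∀ n y,
    (incidenceGraph C).dist (.inl x) (.inl y) = n → ∃ p : G.Walk x y, 2 * p.length = n := by
  intro n
  induction n using Nat.strong_induction_on with
  | _ n ih =>
    intro y hy
    by_cases hxy : y = x
    · subst hxy
      exact ⟨.nil, by simpa using hy⟩
    obtain ⟨p, hp, hd⟩ := h.isTree.exists_adj_closer (r := Sum.inl x) (w := Sum.inl y)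
      (by simpa using hxy)
    obtain ⟨i, rfl, hi⟩ := (adj_inl _ _).1 hp
    obtain ⟨q, hq, hd'⟩ := h.isTree.exists_adj_closer (r := Sum.inl x) (w := Sum.inr i) (by simp)
    obtain ⟨z, rfl, hz⟩ := (adj_inr _ _).1 hq
    obtain ⟨P, hP⟩ := ih (n - 2) (by omega) z (by omega)
    have hzy : G.Adj z y := (h.adj_iff _ _).2 ⟨by rintro rfl; omega, i, hz, hi⟩
    exact ⟨P.concat hzy, by rw [SimpleGraph.Walk.length_concat]; omega⟩

theorem connected (h : IsGammaBlocks a b G C) (hb : 0 < b) : G.Connected := by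
  have : Nonempty V := by
    obtain ⟨v | i⟩ := h.isTree.connected.nonempty
    · exact ⟨v⟩
    · obtain ⟨v, -⟩ := Set.nonempty_of_ncard_ne_zero (s := C i) (by rw [h.ncard_block]; omega)
      exact ⟨v⟩
  exact ⟨fun x y => ⟨(h.exists_walk x _ y rfl).choose⟩⟩

theorem dist_inl (h : IsGammaBlocks a b G C) (x y : V) :
    (incidenceGraph C).dist (.inl x) (.inl y) = 2 * G.dist x y := by
  obtain ⟨p, hp⟩ := h.exists_walk x _ y rfl
  apply le_antisymm
  · obtain ⟨q, hq⟩ := p.reachable.exists_walk_length_eq_dist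
    rw [← hq]
    clear hp hq p
    induction q with
    | nil => simp
    | @cons u v w huv q ih =>
      obtain ⟨-, i, hu, hv⟩ := (h.adj_iff _ _).1 huv
      have h1 := SimpleGraph.dist_eq_one_iff_adj.2 (adj_mk hu)
      have h2 := SimpleGraph.dist_eq_one_iff_adj.2 (adj_mk hv)
      have h3 := h.isTree.connected.dist_triangle (u := Sum.inl u) (v := Sum.inr i) (w := Sum.inl v)
      have h4 := h.isTree.connected.dist_triangle (u := Sum.inl u) (v := Sum.inl v) (w := Sum.inl w)
      rw [SimpleGraph.dist_comm (u := Sum.inr i)] at h3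
      rw [SimpleGraph.Walk.length_cons]
      omega
  · rw [← hp]
    exact Nat.mul_le_mul_left _ (SimpleGraph.dist_le _)

/-- Every block has a point nearest to `x`; the other points are one step farther. -/
theorem exists_gate (h : IsGammaBlocks a b G C) (x : V) (i : ι) :
    ∃ e ∈ C i, ((incidenceGraph C).dist (.inl x) (.inr i) = 2 * G.dist x e + 1) ∧
      ∀ w ∈ C i, w ≠ e → G.dist x w = G.dist x e + 1 := by
  obtain ⟨q, hq, hd⟩ := h.isTree.exists_adj_closer (r := Sum.inl x) (w := Sum.inr i) (by simp)
  obtain ⟨e, rfl, he⟩ := (adj_inr _ _).1 hq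
  refine ⟨e, he, by rw [hd, h.dist_inl], fun w hw hwe => ?_⟩
  have := h.isTree.dist_of_ne_closer hq (adj_mk hw).symm hd (by simpa using hwe)
  rw [hd, h.dist_inl, h.dist_inl] at this
  omega

/-- Among the blocks at `v ≠ x` exactly one contains a point nearer to `x`. -/
theorem exists_block (h : IsGammaBlocks a b G C) {x v : V} (hv : v ≠ x) :
    ∃ i, v ∈ C i ∧ (∃ e ∈ C i, e ≠ v ∧ G.dist x v = G.dist x e + 1 ∧
        ∀ w ∈ C i, w ≠ e → G.dist x w = G.dist x v) ∧
      ∀ j, v ∈ C j → j ≠ i → ∀ w ∈ C j, w ≠ v → G.dist x w = G.dist x v + 1 := by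
  obtain ⟨q, hq, hd⟩ := h.isTree.exists_adj_closer (r := Sum.inl x) (w := Sum.inl v)
    (by simpa using hv)
  obtain ⟨i, rfl, hi⟩ := (adj_inl _ _).1 hq
  rw [h.dist_inl] at hd
  refine ⟨i, hi, ?_, fun j hj hji w hw hwv => ?_⟩
  · obtain ⟨e, he, hde, hw⟩ := h.exists_gate x i
    have hev : e ≠ v := by rintro rfl; omega
    refine ⟨e, he, hev, by omega, fun w hwi hwe => ?_⟩
    rw [hw w hwi hwe]; omega
  · obtain ⟨e, he, hde, hw'⟩ := h.exists_gate x j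
    have h1 := h.isTree.dist_of_ne_closer hq (adj_mk hj) (by rw [h.dist_inl, hd])
      (by simpa using hji)
    rw [h.dist_inl] at h1
    have : v = e := by
      by_contra hne
      have := hw' v hj hne
      omega
    subst this
    exact hw' w hw hwv

/-- The tree path from `w` to the block `j` runs through `v`, so `v` is the point of `C j` nearest
to `w`. -/
theorem dist_of_mem_block (h : IsGammaBlocks a b G C) {i j : ι} {v w z : V} (hi : v ∈ C i)
    (hj : v ∈ C j) (hij : i ≠ j) (hw : w ∈ C i) (hz : z ∈ C j) (hwv : w ≠ v) (hzv : z ≠ v) :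
    G.dist w z = 2 := by
  have hw1 : G.dist w v = 1 :=
    SimpleGraph.dist_eq_one_iff_adj.2 ((h.adj_iff _ _).2 ⟨hwv, i, hw, hi⟩)
  have h1 := SimpleGraph.dist_eq_one_iff_adj.2 (adj_mk hw)
  have h2 := h.isTree.dist_of_ne_closer (r := Sum.inl w) (w := Sum.inl v) (adj_mk hi) (adj_mk hj)
    (by rw [h1, h.dist_inl, hw1]) (by simpa using hij.symm)
  obtain ⟨e, he, hde, hz'⟩ := h.exists_gate w j
  rw [h.dist_inl] at h2
  have : v = e := by
    by_contra hne
    have := hz' v hj hne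
    omega
  subst this
  rw [hz' z hz hzv, hw1]

theorem block_unique (h : IsGammaBlocks a b G C) {i j : ι} {v w : V} (hvw : v ≠ w) (hi : v ∈ C i)
    (hj : v ∈ C j) (hi' : w ∈ C i) (hj' : w ∈ C j) : i = j := by
  by_contra hij
  have := h.dist_of_mem_block hi hj hij hi' hj' hvw.symm hvw.symm
  simp at this

/-- Outside a block `C i₀`, a point `w` hangs below a point `v` of a block `C i`, such that every
point not deeper than `w` is a child of `v`, or `v`, or enters `C i` through another point. -/
theorem exists_peel (h : IsGammaBlocks a b G C) {i₀ : ι} {w : V} (hw : w ∉ C i₀) :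
    ∃ i v, v ∈ C i ∧ w ∉ C i ∧ G.Adj v w ∧
      (∀ u ∈ C i, (incidenceGraph C).dist (.inr i₀) (.inl u) <
        (incidenceGraph C).dist (.inr i₀) (.inl w)) ∧
      ∀ u, (incidenceGraph C).dist (.inr i₀) (.inl u) ≤
          (incidenceGraph C).dist (.inr i₀) (.inl w) →
        (G.Adj v u ∧ u ∉ C i) ∨ u = v ∨ ∃ e ∈ C i, e ≠ v ∧ G.dist u v = G.dist u e + 1 ∧
          ∀ z ∈ C i, z ≠ e → G.dist u z = G.dist u v := by
  -- Climb three tree edges from `w` towards `i₀`: to the block `j`, the point `v`, the block `i`.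
  -- The second edge exists because `w ∉ C i₀` forces `j ≠ i₀`.
  obtain ⟨q, hq, hd⟩ := h.isTree.exists_adj_closer (r := Sum.inr i₀) (w := Sum.inl w) (by simp)
  obtain ⟨j, rfl, hj⟩ := (adj_inl _ _).1 hq
  obtain ⟨q, hq', hd'⟩ := h.isTree.exists_adj_closer (r := Sum.inr i₀) (w := Sum.inr j)
    (by rintro e; apply hw; rwa [← Sum.inr_injective e])
  obtain ⟨v, rfl, hv⟩ := (adj_inr _ _).1 hq'
  obtain ⟨q, hq'', hd''⟩ := h.isTree.exists_adj_closer (r := Sum.inr i₀) (w := Sum.inl v) (by simp)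
  obtain ⟨i, rfl, hi⟩ := (adj_inl _ _).1 hq''
  have hij : i ≠ j := by rintro rfl; omega
  have hvw : v ≠ w := by rintro rfl; omega
  refine ⟨i, v, hi, fun hw' => hij (h.block_unique hvw hi hv hw' hj),
    (h.adj_iff _ _).2 ⟨hvw, j, hv, hj⟩, fun u hu => ?_, fun u hu => ?_⟩
  · have := h.isTree.dist_eq_dist_add_one_of_adj (Sum.inr i₀) (adj_mk hu)
    omega
  · by_cases huv : u = v
    · exact Or.inr (Or.inl huv)
    obtain ⟨e, he, hde, hz⟩ := h.exists_gate u i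
    by_cases hev : e = v
    · subst hev
      left
      have h1 := h.isTree.dist_eq_add_of_separates hq'' hd'' (Sum.inl u) (by
        rw [SimpleGraph.dist_comm, hde, h.dist_inl, SimpleGraph.dist_comm])
      rw [h.dist_inl] at h1
      have h2 := h.isTree.connected.pos_dist_of_ne (u := Sum.inl e) (v := Sum.inl u) (by simpa using Ne.symm huv)
      rw [h.dist_inl] at h2
      have h3 : G.dist e u = 1 := by omega
      refine ⟨SimpleGraph.dist_eq_one_iff_adj.1 h3, fun hui => ?_⟩
      have h4 := SimpleGraph.dist_eq_one_iff_adj.2 (adj_mk hui)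
      rw [SimpleGraph.dist_comm] at h3
      omega
    · right; right
      refine ⟨e, he, hev, hz v hi (Ne.symm hev), fun z hzi hze => ?_⟩
      rw [hz z hzi hze, hz v hi (Ne.symm hev)]

end IsGammaBlocks

/-! ### Spheres, the neighbour recurrence and distance-regularity. -/

open Classical in
/-- The elements of a finite set as a `Finset`; empty for an infinite set. -/
noncomputable def finsetOf {α : Type*} (s : Set α) : Finset α :=
  if h : s.Finite then h.toFinset else ∅

theorem mem_finsetOf {α : Type*} {s : Set α} (h : s.Finite) {x : α} : x ∈ finsetOf s ↔ x ∈ s := by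
  simp [finsetOf, h]

theorem card_finsetOf {α : Type*} {s : Set α} (h : s.Finite) : (finsetOf s).card = s.ncard := by
  simp [finsetOf, h, Set.ncard_eq_toFinset_card]

/-- The sphere of radius `n` about `x`, for locally finite graphs. -/
noncomputable def SimpleGraph.sphereFinset {V : Type*} (G : SimpleGraph V) (x : V) (n : ℕ) :
    Finset V :=
  finsetOf {z | G.dist x z = n}

namespace IsGammaBlocks

variable {a b : ℕ} {V ι : Type*} {G : SimpleGraph V} {C : ι → Set V}

theorem finite_block (h : IsGammaBlocks a b G C) (hb : 2 ≤ b) (i : ι) : (C i).Finite :=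
  Set.finite_of_ncard_ne_zero (by rw [h.ncard_block]; omega)

theorem finite_at (h : IsGammaBlocks a b G C) (ha : 2 ≤ a) (v : V) : {i | v ∈ C i}.Finite :=
  Set.finite_of_ncard_ne_zero (by rw [h.ncard_at]; omega)

theorem finite_neighborSet (h : IsGammaBlocks a b G C) (ha : 2 ≤ a) (hb : 2 ≤ b) (v : V) :
    (G.neighborSet v).Finite := by
  refine ((h.finite_at ha v).biUnion (fun i _ => h.finite_block hb i)).subset ?_
  intro w hw
  obtain ⟨-, i, hi, hw⟩ := (h.adj_iff _ _).1 hw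
  exact Set.mem_biUnion (show i ∈ {i | v ∈ C i} from hi) hw

theorem finite_sphere (h : IsGammaBlocks a b G C) (ha : 2 ≤ a) (hb : 2 ≤ b) (x : V) (n : ℕ) :
    {z | G.dist x z = n}.Finite := by
  have hc := h.connected (by omega)
  induction n with
  | zero =>
    refine (Set.finite_singleton x).subset ?_
    intro z hz
    exact (hc.dist_eq_zero_iff.1 hz).symm
  | succ n ih =>
    refine (ih.biUnion (fun z _ => h.finite_neighborSet ha hb z)).subset ?_
    intro z hz
    have hz' : G.dist x z = n + 1 := hz
    obtain ⟨i, hi, ⟨e, he, hev, hd, -⟩, -⟩ := h.exists_block (x := x) (v := z)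
      (by rintro rfl; simp at hz')
    refine Set.mem_biUnion (x := e) (show G.dist x e = n by omega) ?_
    exact (h.adj_iff _ _).2 ⟨hev, i, he, hi⟩

theorem mem_sphereFinset (h : IsGammaBlocks a b G C) (ha : 2 ≤ a) (hb : 2 ≤ b) {x z : V} {n : ℕ} :
    z ∈ G.sphereFinset x n ↔ G.dist x z = n :=
  mem_finsetOf (h.finite_sphere ha hb x n)

theorem sphereFinset_zero (h : IsGammaBlocks a b G C) (ha : 2 ≤ a) (hb : 2 ≤ b) (x : V) :
    G.sphereFinset x 0 = {x} := by
  ext z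
  rw [h.mem_sphereFinset ha hb, (h.connected (by omega)).dist_eq_zero_iff, Finset.mem_singleton,
    eq_comm]

/-- The sum of `g` over the distances from the neighbours of a point to a point at distance `n`
from it. -/
def neighborSum (a b : ℕ) {E : Type*} [AddCommMonoid E] (g : ℕ → E) : ℕ → E
  | 0 => (a * (b - 1)) • g 1
  | n + 1 => g n + (b - 2) • g (n + 1) + ((a - 1) * (b - 1)) • g (n + 2)

open Classical in
theorem sphereFinset_one (h : IsGammaBlocks a b G C) (ha : 2 ≤ a) (hb : 2 ≤ b) (x : V) :
    G.sphereFinset x 1 =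
      (finsetOf {i | x ∈ C i}).biUnion (fun i => (finsetOf (C i)).erase x) := by
  ext z
  simp only [h.mem_sphereFinset ha hb, SimpleGraph.dist_eq_one_iff_adj, h.adj_iff,
    Finset.mem_biUnion, mem_finsetOf (h.finite_at ha x), Finset.mem_erase,
    mem_finsetOf (h.finite_block hb _), Set.mem_ofPred_eq]
  constructor
  · rintro ⟨h1, i, h2, h3⟩
    exact ⟨i, h2, h1.symm, h3⟩
  · rintro ⟨i, h2, h1, h3⟩
    exact ⟨h1.symm, i, h2, h3⟩

/-- For `x ≠ y` one block at `x` contains a single point nearer to `y` and `b - 2` further points as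
far as `x`; the other `a - 1` blocks have `b - 1` points each, all one step farther. -/
theorem sum_neighbors (h : IsGammaBlocks a b G C) (ha : 2 ≤ a) (hb : 2 ≤ b) {E : Type*}
    [AddCommMonoid E] (g : ℕ → E) (x y : V) :
    ∑ z ∈ G.sphereFinset x 1, g (G.dist y z) = neighborSum a b g (G.dist y x) := by
  classical
  have hI : (finsetOf {i | x ∈ C i}).card = a := by
    rw [card_finsetOf (h.finite_at ha x), h.ncard_at]
  have hB : ∀ i, x ∈ C i → ((finsetOf (C i)).erase x).card = b - 1 := by
    intro i hi
    rw [Finset.card_erase_of_mem ((mem_finsetOf (h.finite_block hb i)).2 hi),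
      card_finsetOf (h.finite_block hb i), h.ncard_block]
  rw [h.sphereFinset_one ha hb, Finset.sum_biUnion]
  · by_cases hxy : x = y
    · subst hxy
      rw [SimpleGraph.dist_self]
      have : ∀ i ∈ finsetOf {i | x ∈ C i},
          ∑ z ∈ (finsetOf (C i)).erase x, g (G.dist x z) = (b - 1) • g 1 := by
        intro i hi
        rw [mem_finsetOf (h.finite_at ha x)] at hi
        rw [Finset.sum_congr rfl (g := fun _ => g 1), Finset.sum_const, hB i hi]
        intro z hz
        rw [Finset.mem_erase, mem_finsetOf (h.finite_block hb i)] at hz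
        rw [SimpleGraph.dist_eq_one_iff_adj.2 ((h.adj_iff _ _).2 ⟨hz.1.symm, i, hi, hz.2⟩)]
      rw [Finset.sum_congr rfl this, Finset.sum_const, hI, smul_smul]
      rfl
    · obtain ⟨i, hi, ⟨e, he, hex, hd, hw⟩, hj⟩ := h.exists_block hxy
      obtain ⟨n, hn⟩ : ∃ n, G.dist y e = n := ⟨_, rfl⟩
      rw [hn] at hd
      rw [hd]
      have hi' : i ∈ finsetOf {i | x ∈ C i} := (mem_finsetOf (h.finite_at ha x)).2 hi
      rw [← Finset.add_sum_erase _ _ hi']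
      have he' : e ∈ (finsetOf (C i)).erase x :=
        Finset.mem_erase.2 ⟨hex, (mem_finsetOf (h.finite_block hb i)).2 he⟩
      rw [← Finset.add_sum_erase _ _ he', hn]
      unfold neighborSum
      congr 2
      · rw [Finset.sum_congr rfl (g := fun _ => g (n + 1)), Finset.sum_const,
          Finset.card_erase_of_mem he', hB i hi]
        · rfl
        · intro z hz
          simp only [Finset.mem_erase, mem_finsetOf (h.finite_block hb i)] at hz
          rw [hw z hz.2.2 hz.1, hd]
      · have : ∀ j ∈ (finsetOf {i | x ∈ C i}).erase i,
            ∑ z ∈ (finsetOf (C j)).erase x, g (G.dist y z) = (b - 1) • g (n + 2) := by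
          intro j hj'
          rw [Finset.mem_erase, mem_finsetOf (h.finite_at ha x)] at hj'
          rw [Finset.sum_congr rfl (g := fun _ => g (n + 2)), Finset.sum_const, hB j hj'.2]
          intro z hz
          simp only [Finset.mem_erase, mem_finsetOf (h.finite_block hb j)] at hz
          rw [hj j hj'.2 hj'.1 z hz.2 hz.1, hd]
        rw [Finset.sum_congr rfl this, Finset.sum_const, Finset.card_erase_of_mem hi', hI,
          smul_smul]
  · intro i hi j hj hij
    rw [Finset.mem_coe, mem_finsetOf (h.finite_at ha x)] at hi hj
    refine Finset.disjoint_left.2 fun z hz hz' => hij ?_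
    rw [Finset.mem_erase, mem_finsetOf (h.finite_block hb _)] at hz hz'
    exact h.block_unique hz.1 hz.2 hz'.2 hi hj

/-- The number of neighbours of a point `x` that are one step farther from a point at
distance `n` from `x`. -/
def upDegree (a b : ℕ) : ℕ → ℕ
  | 0 => a * (b - 1)
  | _ + 1 => (a - 1) * (b - 1)

/-- Exchanging the sums, each `z` is counted once for every neighbour of `x` at distance `i + 1`
from it, a number given by `sum_neighbors` for an indicator. This three-term recurrence drives every
induction on the radius. -/
theorem sum_neighbors_sum_sphere (h : IsGammaBlocks a b G C) (ha : 2 ≤ a) (hb : 2 ≤ b) {E : Type*}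
    [AddCommMonoid E] (F : V → E) (x : V) (i : ℕ) :
    ∑ y ∈ G.sphereFinset x 1, ∑ z ∈ G.sphereFinset y (i + 1), F z =
      upDegree a b i • (∑ z ∈ G.sphereFinset x i, F z) +
        (b - 2) • (∑ z ∈ G.sphereFinset x (i + 1), F z) + ∑ z ∈ G.sphereFinset x (i + 2), F z := by
  classical
  have hc := h.connected (by omega)
  let U := G.sphereFinset x i ∪ G.sphereFinset x (i + 1) ∪ G.sphereFinset x (i + 2)
  have hdisj : ∀ m n, m ≠ n → Disjoint (G.sphereFinset x m) (G.sphereFinset x n) := by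
    intro m n hmn
    refine Finset.disjoint_left.2 fun z hz hz' => hmn ?_
    rw [h.mem_sphereFinset ha hb] at hz hz'
    omega
  have hcount : ∀ z, ((G.sphereFinset x 1).filter (fun y => G.dist z y = i + 1)).card =
      neighborSum a b (fun n => if n = i + 1 then 1 else 0) (G.dist z x) := by
    intro z
    rw [← h.sum_neighbors ha hb, Finset.card_filter]
  rw [Finset.sum_comm' (t' := U)
    (s' := fun z => (G.sphereFinset x 1).filter (fun y => G.dist z y = i + 1))]
  · simp only [Finset.sum_const, hcount]
    rw [Finset.sum_union, Finset.sum_union (hdisj _ _ (by omega)), Finset.smul_sum,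
      Finset.smul_sum]
    · congr 1
      · congr 1
        · refine Finset.sum_congr rfl fun z hz => ?_
          rw [h.mem_sphereFinset ha hb, SimpleGraph.dist_comm] at hz
          rw [hz]
          cases i with
          | zero => simp [neighborSum, upDegree]
          | succ i =>
            have hne : i ≠ i + 1 + 1 := by omega
            simp [neighborSum, upDegree, hne]
        · refine Finset.sum_congr rfl fun z hz => ?_
          rw [h.mem_sphereFinset ha hb, SimpleGraph.dist_comm] at hz
          rw [hz]
          simp [neighborSum]
      · refine Finset.sum_congr rfl fun z hz => ?_
        rw [h.mem_sphereFinset ha hb, SimpleGraph.dist_comm] at hz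
        rw [hz]
        simp [neighborSum]
    · rw [Finset.disjoint_union_left]
      exact ⟨hdisj _ _ (by omega), hdisj _ _ (by omega)⟩
  · intro y z
    simp only [U, Finset.mem_union, Finset.mem_filter, h.mem_sphereFinset ha hb]
    rw [SimpleGraph.dist_comm (u := z) (v := y)]
    constructor
    · rintro ⟨h1, h2⟩
      have h3 := hc.dist_triangle (u := x) (v := y) (w := z)
      have h4 := hc.dist_triangle (u := y) (v := x) (w := z)
      rw [SimpleGraph.dist_comm (u := y) (v := x)] at h4
      exact ⟨⟨h1, h2⟩, by omega⟩
    · rintro ⟨h1, h2⟩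
      exact h1

/-- Spherical sums of radial functions are radial. -/
theorem exists_radial_sum (h : IsGammaBlocks a b G C) (ha : 2 ≤ a) (hb : 2 ≤ b) {E : Type*}
    [AddCommGroup E] (g : ℕ → E) (i : ℕ) :
    ∃ g' : ℕ → E, ∀ x y, ∑ z ∈ G.sphereFinset x i, g (G.dist y z) = g' (G.dist y x) := by
  induction i using Nat.twoStepInduction with
  | zero => exact ⟨g, fun x y => by rw [h.sphereFinset_zero ha hb, Finset.sum_singleton]⟩
  | one => exact ⟨neighborSum a b g, fun x y => h.sum_neighbors ha hb g x y⟩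
  | more i ih1 ih2 =>
    obtain ⟨g1, h1⟩ := ih1
    obtain ⟨g2, h2⟩ := ih2
    -- The three-term recurrence solved for the outermost sphere; the subtraction is why `E` is a
    -- group, and why counting below is done in `ℤ`.
    refine ⟨fun n => neighborSum a b g2 n - (upDegree a b i • g1 n + (b - 2) • g2 n),
      fun x y => ?_⟩
    have := h.sum_neighbors_sum_sphere ha hb (fun z => g (G.dist y z)) x i
    rw [h1, h2, Finset.sum_congr rfl (fun x' _ => h2 x' y), h.sum_neighbors ha hb] at this
    beta_reduce
    rw [this]
    abel

theorem sphereInterCard_eq_sum (h : IsGammaBlocks a b G C) (ha : 2 ≤ a) (hb : 2 ≤ b) (x y : V)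
    (i j : ℕ) :
    sphereInterCard G x y i j = ∑ z ∈ G.sphereFinset x i, if G.dist y z = j then 1 else 0 := by
  rw [← Finset.card_filter, sphereInterCard, ← Set.ncard_coe_finset]
  congr 1
  ext z
  simp [h.mem_sphereFinset ha hb]

theorem isDistanceRegular (h : IsGammaBlocks a b G C) (ha : 2 ≤ a) (hb : 2 ≤ b) :
    IsDistanceRegular G := by
  refine ⟨h.connected (by omega), h.finite_neighborSet ha hb, fun i j x y x' y' hd => ?_⟩
  obtain ⟨g, hg⟩ := h.exists_radial_sum ha hb (fun n => if n = j then (1 : ℤ) else 0) i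
  have : ∀ x y, (sphereInterCard G x y i j : ℤ) = g (G.dist y x) := by
    intro x y
    rw [h.sphereInterCard_eq_sum ha hb, ← hg]
    push_cast
    rfl
  have h1 := this x y
  have h2 := this x' y'
  rw [SimpleGraph.dist_comm, hd, SimpleGraph.dist_comm, ← h2] at h1
  exact_mod_cast h1

theorem exists_dist_eq (h : IsGammaBlocks a b G C) (ha : 2 ≤ a) (hb : 2 ≤ b) (x : V) (k : ℕ) :
    ∃ y, G.dist x y = k := by
  induction k with
  | zero => exact ⟨x, by simp⟩
  | succ k ih =>
    obtain ⟨y, hy⟩ := ih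
    by_contra hne
    push Not at hne
    have := h.sum_neighbors ha hb (fun n => if n = k + 1 then 1 else 0) y x
    rw [hy, Finset.sum_eq_zero (fun z _ => if_neg (hne z))] at this
    have h1 : 0 < a * (b - 1) := Nat.mul_pos (by omega) (by omega)
    have h2 : 0 < (a - 1) * (b - 1) := Nat.mul_pos (by omega) (by omega)
    cases k <;> simp [neighborSum] at this <;> omega

/-! ### Sphere sizes and convolution weights. -/

/-- The number of points of a sphere of radius `n`. -/
def sphereSize (a b : ℕ) : ℕ → ℕ
  | 0 => 1
  | n + 1 => upDegree a b n * sphereSize a b n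

theorem sphereSize_pos (ha : 2 ≤ a) (hb : 2 ≤ b) (n : ℕ) : 0 < sphereSize a b n := by
  induction n with
  | zero => exact Nat.one_pos
  | succ n ih =>
    refine Nat.mul_pos ?_ ih
    cases n <;> exact Nat.mul_pos (by omega) (by omega)

/-- Spherical sums and the values `φ i` obey the same three-term recurrence in the radius. With `φ =
1` this counts spheres; in general it is the product formula for spherical functions. -/
theorem sum_sphere_of_eigen (h : IsGammaBlocks a b G C) (ha : 2 ≤ a) (hb : 2 ≤ b) {R : Type*}
    [CommRing R] (φ : ℕ → R) (h0 : φ 0 = 1)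
    (hφ : ∀ n, neighborSum a b φ n = (a * (b - 1) : ℕ) • (φ 1 * φ n)) (i : ℕ) (x y : V) :
    ∑ z ∈ G.sphereFinset x i, φ (G.dist y z) = sphereSize a b i • (φ i * φ (G.dist y x)) := by
  induction i using Nat.twoStepInduction generalizing x with
  | zero => rw [h.sphereFinset_zero ha hb, Finset.sum_singleton, h0]; simp [sphereSize]
  | one => rw [h.sum_neighbors ha hb, hφ]; simp [sphereSize, upDegree]
  | more i ih1 ih2 =>
    have h1 := h.sum_neighbors_sum_sphere ha hb (fun z => φ (G.dist y z)) x i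
    rw [ih1, ih2, Finset.sum_congr rfl (fun x' _ => ih2 x'), ← Finset.smul_sum, ← Finset.mul_sum,
      h.sum_neighbors ha hb, hφ] at h1
    have h2 := hφ (i + 1)
    simp only [neighborSum] at h2
    simp only [sphereSize, nsmul_eq_mul, Nat.cast_mul] at h1 h2 ⊢
    have h3 : upDegree a b (i + 1) = (a - 1) * (b - 1) := rfl
    rw [h3]
    push_cast at h1 h2 ⊢
    linear_combination (-1 : R) * h1 - (upDegree a b i * sphereSize a b i : R) *
      φ (G.dist y x) * h2

theorem card_sphereFinset (h : IsGammaBlocks a b G C) (ha : 2 ≤ a) (hb : 2 ≤ b) (x : V) (n : ℕ) :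
    (G.sphereFinset x n).card = sphereSize a b n := by
  have := h.sum_sphere_of_eigen ha hb (fun _ => (1 : ℤ)) rfl (fun n => ?_) n x x
  · simpa using this
  · obtain ⟨a, rfl⟩ := Nat.exists_eq_add_of_le ha
    obtain ⟨b, rfl⟩ := Nat.exists_eq_add_of_le hb
    have e1 : 2 + b - 1 = b + 1 := by omega
    have e2 : 2 + b - 2 = b := by omega
    have e3 : 2 + a - 1 = a + 1 := by omega
    cases n with
    | zero => simp [neighborSum]
    | succ n =>
      simp only [neighborSum, e1, e2, e3, nsmul_eq_mul]
      push_cast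
      ring

theorem intersectionNumber_eq (h : IsGammaBlocks a b G C) (ha : 2 ≤ a) (hb : 2 ≤ b) (x y : V)
    (i j : ℕ) : intersectionNumber G i j (G.dist x y) = sphereInterCard G x y i j := by
  have hex : ∃ p : V × V, G.dist p.1 p.2 = G.dist x y := ⟨(x, y), rfl⟩
  rw [intersectionNumber, dif_pos hex]
  exact (h.isDistanceRegular ha hb).2.2 _ _ _ _ _ _ hex.choose_spec

theorem sphereCard_eq (h : IsGammaBlocks a b G C) (ha : 2 ≤ a) (hb : 2 ≤ b) (k : ℕ) :
    sphereCard G k = sphereSize a b k := by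
  obtain ⟨x⟩ := (h.connected (by omega)).nonempty
  have := h.intersectionNumber_eq ha hb x x k k
  rw [SimpleGraph.dist_self] at this
  rw [sphereCard, this, h.sphereInterCard_eq_sum ha hb, ← h.card_sphereFinset ha hb x,
    Finset.card_eq_sum_ones]
  exact Finset.sum_congr rfl fun z hz => if_pos ((h.mem_sphereFinset ha hb).1 hz)

/-- Both sides count pairs at distance `j`, one point on each of the spheres of radius `k` and `i`
about a fixed vertex. -/
theorem sphereSize_mul_intersectionNumber (h : IsGammaBlocks a b G C) (ha : 2 ≤ a) (hb : 2 ≤ b)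
    (i j k : ℕ) : sphereSize a b k * intersectionNumber G i j k =
      sphereSize a b i * intersectionNumber G k j i := by
  obtain ⟨x⟩ := (h.connected (by omega)).nonempty
  have key : ∀ i k, sphereSize a b k * intersectionNumber G i j k = ∑ z ∈ G.sphereFinset x k,
      ∑ y ∈ G.sphereFinset x i, if G.dist z y = j then 1 else 0 := by
    intro i k
    rw [← h.card_sphereFinset ha hb x, ← smul_eq_mul, ← Finset.sum_const]
    refine Finset.sum_congr rfl fun z hz => ?_
    rw [← (h.mem_sphereFinset ha hb).1 hz, h.intersectionNumber_eq ha hb,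
      h.sphereInterCard_eq_sum ha hb]
  rw [key, key, Finset.sum_comm]
  refine Finset.sum_congr rfl fun z _ => Finset.sum_congr rfl fun y _ => ?_
  rw [SimpleGraph.dist_comm]

theorem convWeight_eq (h : IsGammaBlocks a b G C) (ha : 2 ≤ a) (hb : 2 ≤ b) (i j k : ℕ) :
    convWeight G i j k = (sphereSize a b j : ℝ)⁻¹ * intersectionNumber G k j i := by
  have h1 : (sphereSize a b i : ℝ) ≠ 0 := by exact_mod_cast (sphereSize_pos ha hb i).ne'
  have h2 : (sphereSize a b j : ℝ) ≠ 0 := by exact_mod_cast (sphereSize_pos ha hb j).ne'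
  have h3 : (sphereSize a b k : ℝ) * intersectionNumber G i j k =
      sphereSize a b i * intersectionNumber G k j i := by
    exact_mod_cast h.sphereSize_mul_intersectionNumber ha hb i j k
  rw [convWeight, h.sphereCard_eq ha hb, h.sphereCard_eq ha hb, h.sphereCard_eq ha hb]
  field_simp
  linear_combination h3

theorem convWeight_nonneg (i j k : ℕ) : 0 ≤ convWeight G i j k := by
  unfold convWeight; positivity

/-- The convolution is the spherical mean. -/
theorem sum_convWeight_smul (h : IsGammaBlocks a b G C) (ha : 2 ≤ a) (hb : 2 ≤ b) {E : Type*}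
    [AddCommGroup E] [Module ℝ E] (f : ℕ → E) (j : ℕ) (x y : V) :
    ∑ k ∈ Finset.Icc (max (G.dist x y) j - min (G.dist x y) j) (G.dist x y + j),
        convWeight G (G.dist x y) j k • f k =
      (sphereSize a b j : ℝ)⁻¹ • ∑ z ∈ G.sphereFinset y j, f (G.dist x z) := by
  have hc := h.connected (by omega)
  rw [← Finset.sum_fiberwise_of_maps_to
    (t := Finset.Icc (max (G.dist x y) j - min (G.dist x y) j) (G.dist x y + j))
    (g := fun z => G.dist x z), Finset.smul_sum]
  · refine Finset.sum_congr rfl fun k _ => ?_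
    rw [h.convWeight_eq ha hb, h.intersectionNumber_eq ha hb, mul_smul]
    congr 1
    rw [Finset.sum_congr rfl (g := fun _ => f k), Finset.sum_const, ← Nat.cast_smul_eq_nsmul ℝ]
    · congr 2
      rw [sphereInterCard, ← Set.ncard_coe_finset]
      congr 1
      ext z
      simp [h.mem_sphereFinset ha hb, and_comm]
    · intro z hz
      rw [(Finset.mem_filter.1 hz).2]
  · intro z hz
    rw [h.mem_sphereFinset ha hb] at hz
    have h1 := hc.dist_triangle (u := x) (v := y) (w := z)
    have h2 := hc.dist_triangle (u := x) (v := z) (w := y)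
    have h3 := hc.dist_triangle (u := y) (v := x) (w := z)
    rw [SimpleGraph.dist_comm (u := z) (v := y)] at h2
    rw [SimpleGraph.dist_comm (u := y) (v := x)] at h3
    rw [Finset.mem_Icc]
    omega

theorem sum_convWeight (h : IsGammaBlocks a b G C) (ha : 2 ≤ a) (hb : 2 ≤ b) (i j : ℕ) :
    ∑ k ∈ Finset.Icc (max i j - min i j) (i + j), convWeight G i j k = 1 := by
  obtain ⟨x⟩ := (h.connected (by omega)).nonempty
  obtain ⟨y, rfl⟩ := h.exists_dist_eq ha hb x i
  have := h.sum_convWeight_smul ha hb (fun _ => (1 : ℝ)) j x y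
  have h2 : (sphereSize a b j : ℝ) ≠ 0 := by exact_mod_cast (sphereSize_pos ha hb j).ne'
  simpa [h.card_sphereFinset ha hb, h2] using this

/-- Eigenfunctions of the nearest neighbour walk are multiplicative on the hypergroup. -/
theorem mul_eq_sum_convWeight (h : IsGammaBlocks a b G C) (ha : 2 ≤ a) (hb : 2 ≤ b) {R : Type*}
    [CommRing R] [Algebra ℝ R] (φ : ℕ → R) (h0 : φ 0 = 1)
    (hφ : ∀ n, neighborSum a b φ n = (a * (b - 1) : ℕ) • (φ 1 * φ n)) (i j : ℕ) :
    φ i * φ j = ∑ k ∈ Finset.Icc (max i j - min i j) (i + j), convWeight G i j k • φ k := by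
  obtain ⟨x⟩ := (h.connected (by omega)).nonempty
  obtain ⟨y, rfl⟩ := h.exists_dist_eq ha hb x i
  have h2 : (sphereSize a b j : ℝ) ≠ 0 := by exact_mod_cast (sphereSize_pos ha hb j).ne'
  rw [h.sum_convWeight_smul ha hb, h.sum_sphere_of_eigen ha hb φ h0 hφ,
    ← Nat.cast_smul_eq_nsmul ℝ, smul_smul, inv_mul_cancel₀ h2, one_smul, mul_comm]

theorem convApply_ofReal (f : ℕ → ℝ) (i j : ℕ) :
    convApply G (fun k => (f k : ℂ)) i j =
      ((∑ k ∈ Finset.Icc (max i j - min i j) (i + j), convWeight G i j k * f k : ℝ) : ℂ) := by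
  rw [convApply]
  push_cast
  exact Finset.sum_congr rfl fun k _ => mul_comm _ _

end IsGammaBlocks

/-! ### The orthogonal polynomials as a basis. -/

open Polynomial in
/-- The polynomials `P n` with `P 1 = X` belonging to the polynomial hypergroup of `Γ(a, b)`. -/
noncomputable def gammaPoly (a b : ℕ) : ℕ → ℝ[X]
  | 0 => 1
  | 1 => X
  | n + 2 => C (((a - 1) * (b - 1) : ℕ) : ℝ)⁻¹ *
      ((C ((a * (b - 1) : ℕ) : ℝ) * X + C (-((b - 2 : ℕ) : ℝ))) * gammaPoly a b (n + 1) -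
        gammaPoly a b n)

open Polynomial IsGammaBlocks

section Polynomials

variable {a b : ℕ}

theorem neighborSum_gammaPoly (ha : 2 ≤ a) (hb : 2 ≤ b) (n : ℕ) :
    neighborSum a b (gammaPoly a b) n =
      (a * (b - 1) : ℕ) • (gammaPoly a b 1 * gammaPoly a b n) := by
  cases n with
  | zero => simp [neighborSum, gammaPoly]
  | succ n =>
    have hQ : (((a - 1) * (b - 1) : ℕ) : ℝ) ≠ 0 := by
      exact_mod_cast (Nat.mul_pos (by omega) (by omega)).ne'
    have hC : C (((a - 1) * (b - 1) : ℕ) : ℝ) * C (((a - 1) * (b - 1) : ℕ) : ℝ)⁻¹ = 1 := by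
      rw [← C_mul, mul_inv_cancel₀ hQ, C_1]
    have e : gammaPoly a b (n + 2) = C (((a - 1) * (b - 1) : ℕ) : ℝ)⁻¹ *
      ((C ((a * (b - 1) : ℕ) : ℝ) * X + C (-((b - 2 : ℕ) : ℝ))) * gammaPoly a b (n + 1) -
        gammaPoly a b n) := rfl
    have e1 : gammaPoly a b 1 = X := rfl
    simp only [neighborSum]
    rw [e, e1]
    simp only [nsmul_eq_mul, map_neg, map_natCast] at hC ⊢
    linear_combination ((((a * (b - 1) : ℕ) : ℝ[X]) * X - ((b - 2 : ℕ) : ℝ[X])) *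
      gammaPoly a b (n + 1) - gammaPoly a b n) * hC

theorem degree_gammaPoly (ha : 2 ≤ a) (hb : 2 ≤ b) (n : ℕ) : (gammaPoly a b n).degree = n := by
  induction n using Nat.twoStepInduction with
  | zero => simp [gammaPoly]
  | one => simp [gammaPoly]
  | more n ih1 ih2 =>
    have hQ : (((a - 1) * (b - 1) : ℕ) : ℝ) ≠ 0 := by
      exact_mod_cast (Nat.mul_pos (by omega) (by omega)).ne'
    have hw : ((a * (b - 1) : ℕ) : ℝ) ≠ 0 := by
      exact_mod_cast (Nat.mul_pos (by omega) (by omega)).ne'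
    have h1 : ((C ((a * (b - 1) : ℕ) : ℝ) * X + C (-((b - 2 : ℕ) : ℝ))) *
        gammaPoly a b (n + 1)).degree = ((n + 2 : ℕ) : WithBot ℕ) := by
      rw [degree_mul, degree_linear hw, ih2]
      norm_cast
      omega
    rw [gammaPoly, degree_C_mul (inv_ne_zero hQ), degree_sub_eq_left_of_degree_lt, h1]
    rw [h1, ih1]
    exact_mod_cast Nat.lt_add_of_pos_right (by omega)

/-- The basis `P n` of the polynomials. -/
noncomputable def gammaSequence (ha : 2 ≤ a) (hb : 2 ≤ b) : Polynomial.Sequence ℝ :=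
  ⟨gammaPoly a b, degree_gammaPoly ha hb⟩

theorem isUnit_leadingCoeff_gammaSequence (ha : 2 ≤ a) (hb : 2 ≤ b) (n : ℕ) :
    IsUnit (gammaSequence ha hb n).leadingCoeff :=
  (leadingCoeff_ne_zero.2 ((gammaSequence ha hb).ne_zero n)).isUnit

theorem span_gammaPoly (ha : 2 ≤ a) (hb : 2 ≤ b) :
    Submodule.span ℝ (Set.range (gammaPoly a b)) = ⊤ :=
  (gammaSequence ha hb).span (isUnit_leadingCoeff_gammaSequence ha hb)

theorem exists_functional (ha : 2 ≤ a) (hb : 2 ≤ b) (f : ℕ → ℝ) :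
    ∃ L : ℝ[X] →ₗ[ℝ] ℝ, ∀ n, L (gammaPoly a b n) = f n := by
  refine ⟨((gammaSequence ha hb).basis (isUnit_leadingCoeff_gammaSequence ha hb)).constr ℝ f,
    fun n => ?_⟩
  have := ((gammaSequence ha hb).basis (isUnit_leadingCoeff_gammaSequence ha hb)).constr_basis ℝ f n
  rwa [Polynomial.Sequence.basis_eq_self] at this

end Polynomials

/-! ### Bounded positive functionals on polynomials. -/

section Positive

theorem sq_functional_mul_le {g : ℝ[X] →ₗ[ℝ] ℝ} (hg : ∀ p, 0 ≤ g (p * p)) (p q : ℝ[X]) :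
    g (p * q) ^ 2 ≤ g (p * p) * g (q * q) := by
  have : ∀ t : ℝ, 0 ≤ g (p * p) * (t * t) + 2 * g (p * q) * t + g (q * q) := by
    intro t
    have h := hg (t • p + q)
    have e : (t • p + q) * (t • p + q) = (t * t) • (p * p) + (2 * t) • (p * q) + q * q := by
      simp only [smul_eq_C_mul, map_mul, map_ofNat]
      ring
    rw [e, map_add, map_add, map_smul, map_smul, smul_eq_mul, smul_eq_mul] at h
    linarith
  have := discrim_le_zero this
  rw [discrim] at this
  linarith

/-- Log-convexity makes the ratios of successive terms nondecreasing. A first ratio `ρ > R` would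
force growth at least like `ρ ^ n`, against a bound that is `R ^ n` up to a linear factor. -/
theorem le_of_logConvex {m : ℕ → ℝ} {K R : ℝ} (hR : 0 < R) (hm : ∀ n, 0 ≤ m n)
    (hlog : ∀ n, m (n + 1) ^ 2 ≤ m n * m (n + 2)) (hK : ∀ n : ℕ, m n ≤ R ^ n * (K * (1 + 4 * n))) :
    m 1 ≤ R * m 0 := by
  by_contra! hlt
  have h0 : 0 < m 0 := by
    rcases (hm 0).eq_or_lt with h | h
    · have := hlog 0
      simp only [← h, zero_mul, mul_zero] at this hlt
      nlinarith
    · exact h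
  set ρ := m 1 / m 0 with hρ
  have hρR : R < ρ := (lt_div_iff₀ h0).2 hlt
  have hρ0 : 0 < ρ := hR.trans hρR
  have hstep : ∀ n, 0 < m n ∧ ρ * m n ≤ m (n + 1) := by
    intro n
    induction n with
    | zero => exact ⟨h0, by rw [hρ]; field_simp; exact le_rfl⟩
    | succ n ih =>
      have h1 : 0 < m (n + 1) := (mul_pos hρ0 ih.1).trans_le ih.2
      refine ⟨h1, ?_⟩
      have h2 := hlog n
      have h3 : m n * (ρ * m (n + 1)) ≤ m n * m (n + 2) := by
        have := mul_le_mul_of_nonneg_right ih.2 h1.le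
        nlinarith
      exact le_of_mul_le_mul_left h3 ih.1
  have hpow : ∀ n, ρ ^ n * m 0 ≤ m n := by
    intro n
    induction n with
    | zero => simp
    | succ n ih =>
      calc ρ ^ (n + 1) * m 0 = ρ * (ρ ^ n * m 0) := by ring
        _ ≤ ρ * m n := by gcongr
        _ ≤ _ := (hstep n).2
  have hr : 1 < ρ / R := (one_lt_div hR).2 hρR
  have hb : ∀ n : ℕ, m 0 ≤ K * ((n : ℝ) ^ 0 / (ρ / R) ^ n) +
      4 * K * ((n : ℝ) ^ 1 / (ρ / R) ^ n) := by
    intro n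
    have h1 := (hpow n).trans (hK n)
    have h2 : 0 < R ^ n := by positivity
    have h3 : 0 < ρ ^ n := by positivity
    have h4 : K * ((n : ℝ) ^ 0 / (ρ / R) ^ n) + 4 * K * ((n : ℝ) ^ 1 / (ρ / R) ^ n) =
      R ^ n * (K * (1 + 4 * n)) / ρ ^ n := by
      rw [div_pow]; field_simp
    rw [h4, le_div_iff₀ h3]
    linarith
  have ht := ((tendsto_pow_const_div_const_pow_of_one_lt 0 hr).const_mul K).add
    ((tendsto_pow_const_div_const_pow_of_one_lt 1 hr).const_mul (4 * K))
  have := ge_of_tendsto' ht hb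
  simp at this
  linarith

variable {a b : ℕ} {V ι : Type*} {G : SimpleGraph V} {C : ι → Set V}

theorem IsGammaBlocks.gammaPoly_mul (h : IsGammaBlocks a b G C) (ha : 2 ≤ a) (hb : 2 ≤ b)
    (i j : ℕ) : gammaPoly a b i * gammaPoly a b j =
      ∑ k ∈ Finset.Icc (max i j - min i j) (i + j), convWeight G i j k • gammaPoly a b k :=
  h.mul_eq_sum_convWeight ha hb _ rfl (neighborSum_gammaPoly ha hb) i j

theorem IsGammaBlocks.abs_functional_mul_le (h : IsGammaBlocks a b G C) (ha : 2 ≤ a) (hb : 2 ≤ b)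
    {g : ℝ[X] →ₗ[ℝ] ℝ} {M : ℝ} (hM : ∀ k, |g (gammaPoly a b k)| ≤ M) (i j : ℕ) :
    |g (gammaPoly a b i * gammaPoly a b j)| ≤ M := by
  rw [h.gammaPoly_mul ha hb, map_sum]
  calc _ ≤ ∑ k ∈ Finset.Icc (max i j - min i j) (i + j), convWeight G i j k * M := by
        refine (Finset.abs_sum_le_sum_abs _ _).trans (Finset.sum_le_sum fun k _ => ?_)
        rw [map_smul, smul_eq_mul, abs_mul, abs_of_nonneg (convWeight_nonneg i j k)]
        exact mul_le_mul_of_nonneg_left (hM k) (convWeight_nonneg i j k)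
    _ = M := by rw [← Finset.sum_mul, h.sum_convWeight ha hb, one_mul]

theorem IsGammaBlocks.exists_bound_mul (h : IsGammaBlocks a b G C) (ha : 2 ≤ a) (hb : 2 ≤ b)
    {g : ℝ[X] →ₗ[ℝ] ℝ} {M : ℝ} (hM : ∀ k, |g (gammaPoly a b k)| ≤ M) (q : ℝ[X]) :
    ∃ M', ∀ k, |g (q * gammaPoly a b k)| ≤ M' := by
  have hq : q ∈ Submodule.span ℝ (Set.range (gammaPoly a b)) := by
    rw [span_gammaPoly ha hb]; trivial
  induction hq using Submodule.span_induction with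
  | mem q hq =>
    obtain ⟨i, rfl⟩ := hq
    exact ⟨M, h.abs_functional_mul_le ha hb hM i⟩
  | zero => exact ⟨0, by simp⟩
  | add p q _ _ hp hq =>
    obtain ⟨A, hA⟩ := hp
    obtain ⟨B, hB⟩ := hq
    refine ⟨A + B, fun k => ?_⟩
    rw [add_mul, map_add]
    exact (abs_add_le _ _).trans (add_le_add (hA k) (hB k))
  | smul r q _ hq =>
    obtain ⟨A, hA⟩ := hq
    refine ⟨|r| * A, fun k => ?_⟩
    rw [smul_mul_assoc, map_smul, smul_eq_mul, abs_mul]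
    exact mul_le_mul_of_nonneg_left (hA k) (abs_nonneg r)

/-- A bounded positive functional is bounded by its value at the unit. -/
theorem IsGammaBlocks.abs_functional_le (h : IsGammaBlocks a b G C) (ha : 2 ≤ a) (hb : 2 ≤ b)
    {g : ℝ[X] →ₗ[ℝ] ℝ} (hg : ∀ p, 0 ≤ g (p * p)) {M : ℝ} (hM : ∀ k, |g (gammaPoly a b k)| ≤ M)
    (k : ℕ) : |g (gammaPoly a b k)| ≤ g 1 := by
  have hbdd : BddAbove (Set.range fun k => |g (gammaPoly a b k)|) :=
    ⟨M, by rintro _ ⟨k, rfl⟩; exact hM k⟩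
  set s := ⨆ k, |g (gammaPoly a b k)| with hs
  have hle : ∀ k, |g (gammaPoly a b k)| ≤ s := fun k => le_ciSup hbdd k
  have hs0 : 0 ≤ s := (abs_nonneg _).trans (hle 0)
  have h1 : 0 ≤ g 1 := by simpa using hg 1
  -- `P k * P k` is a convex combination of the `P m`, so `g` is at most `s` on it; with
  -- Cauchy-Schwarz the supremum satisfies `s² ≤ g 1 * s`.
  have hsq : ∀ k, |g (gammaPoly a b k)| ≤ √(g 1 * s) := by
    intro k
    refine Real.abs_le_sqrt ?_
    have := sq_functional_mul_le hg 1 (gammaPoly a b k)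
    rw [one_mul, one_mul] at this
    exact this.trans (mul_le_mul_of_nonneg_left
      ((le_abs_self _).trans (h.abs_functional_mul_le ha hb hle k k)) h1)
  have hss : s ≤ √(g 1 * s) := ciSup_le hsq
  rw [Real.le_sqrt hs0 (mul_nonneg h1 hs0)] at hss
  refine (hle k).trans ?_
  rcases hs0.eq_or_lt with h' | h'
  · rw [← h']; exact h1
  · nlinarith

/-- With `μ = 2QX - (Q-1)` the recurrence reads `μ P (k+1) = P k + Q P (k+2)`, of total weight `Q +
1`. Only at `0`, where `μ P 0 = 2Q P 1 - (Q-1) P 0`, can the absolute weight be larger. The excess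
is stored in the multiple of `Q⁻¹ ^ k`, which the recurrence reproduces with eigenvalue exactly `Q +
1`; so it grows only linearly in `n`. -/
theorem abs_functional_pow_mul_le {Q : ℕ} (hQ : 1 ≤ Q) {g : ℝ[X] →ₗ[ℝ] ℝ} {M : ℝ}
    (hM : ∀ k, |g (gammaPoly 2 (Q + 1) k)| ≤ M) (n : ℕ) : ∀ k,
    |g ((2 * (Q : ℝ[X]) * X - ((Q : ℝ[X]) - 1)) ^ n * gammaPoly 2 (Q + 1) k)| ≤
      M * (Q + 1) ^ n * (1 + 2 * n * (Q : ℝ)⁻¹ ^ k) := by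
  have hM0 : 0 ≤ M := (abs_nonneg _).trans (hM 0)
  have hQ' : (1 : ℝ) ≤ Q := by exact_mod_cast hQ
  have hrec := neighborSum_gammaPoly (a := 2) (b := Q + 1) le_rfl (by omega)
  have hX : gammaPoly 2 (Q + 1) 1 = X := rfl
  have hone : gammaPoly 2 (Q + 1) 0 = 1 := rfl
  have eQ : ((Q + 1 - 2 : ℕ) : ℝ[X]) = Q - 1 := by
    rw [show Q + 1 - 2 = Q - 1 by omega, Nat.cast_sub hQ, Nat.cast_one]
  induction n with
  | zero => intro k; simpa using hM k
  | succ n ih =>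
    intro k
    set μ : ℝ[X] := 2 * (Q : ℝ[X]) * X - ((Q : ℝ[X]) - 1) with hμ
    cases k with
    | zero =>
      have e : μ ^ (n + 1) * gammaPoly 2 (Q + 1) 0 =
          (2 * (Q : ℝ)) • (μ ^ n * gammaPoly 2 (Q + 1) 1) -
            ((Q : ℝ) - 1) • (μ ^ n * gammaPoly 2 (Q + 1) 0) := by
        rw [hX, hone, pow_succ]
        simp only [smul_eq_C_mul, map_mul, map_sub, map_natCast, map_ofNat, map_one]
        rw [hμ]; ring
      rw [e, map_sub, map_smul, map_smul, smul_eq_mul, smul_eq_mul]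
      have h0 := ih 0
      have h1 := ih 1
      calc _ ≤ 2 * (Q : ℝ) * |g (μ ^ n * gammaPoly 2 (Q + 1) 1)| +
            ((Q : ℝ) - 1) * |g (μ ^ n * gammaPoly 2 (Q + 1) 0)| := by
            refine (abs_sub _ _).trans (le_of_eq ?_)
            rw [abs_mul (2 * (Q : ℝ)), abs_mul ((Q : ℝ) - 1),
              abs_of_nonneg (by positivity : 0 ≤ 2 * (Q : ℝ)),
              abs_of_nonneg (by linarith : 0 ≤ (Q : ℝ) - 1)]
        _ ≤ 2 * (Q : ℝ) * (M * (Q + 1) ^ n * (1 + 2 * n * (Q : ℝ)⁻¹ ^ 1)) +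
            ((Q : ℝ) - 1) * (M * (Q + 1) ^ n * (1 + 2 * n * (Q : ℝ)⁻¹ ^ 0)) :=
            add_le_add (mul_le_mul_of_nonneg_left h1 (by positivity))
              (mul_le_mul_of_nonneg_left h0 (by linarith))
        _ = M * (Q + 1) ^ n * ((Q + 1) * (1 + 2 * n) + 2 * (Q - 1)) := by
            field_simp
            ring
        _ ≤ M * (Q + 1) ^ n * ((Q + 1) * (1 + 2 * (n + 1))) := by
            refine mul_le_mul_of_nonneg_left ?_ (by positivity)
            nlinarith
        _ = _ := by push_cast; ring
    | succ k =>
      have e : μ ^ (n + 1) * gammaPoly 2 (Q + 1) (k + 1) =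
          μ ^ n * gammaPoly 2 (Q + 1) k + (Q : ℝ) • (μ ^ n * gammaPoly 2 (Q + 1) (k + 2)) := by
        have := hrec (k + 1)
        simp only [neighborSum, nsmul_eq_mul, hX, eQ] at this
        simp only [smul_eq_C_mul, map_natCast]
        rw [pow_succ, hμ]
        simp only [Nat.add_sub_cancel, Nat.reduceSub, one_mul] at this
        push_cast at this
        linear_combination (-(2 * (Q : ℝ[X]) * X - ((Q : ℝ[X]) - 1)) ^ n) * this
      rw [e, map_add, map_smul, smul_eq_mul]
      have h0 := ih k
      have h1 := ih (k + 2)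
      calc _ ≤ |g (μ ^ n * gammaPoly 2 (Q + 1) k)| +
            (Q : ℝ) * |g (μ ^ n * gammaPoly 2 (Q + 1) (k + 2))| := by
            refine (abs_add_le _ _).trans (le_of_eq ?_)
            rw [abs_mul, abs_of_nonneg (by positivity : 0 ≤ (Q : ℝ))]
        _ ≤ M * (Q + 1) ^ n * (1 + 2 * n * (Q : ℝ)⁻¹ ^ k) +
            (Q : ℝ) * (M * (Q + 1) ^ n * (1 + 2 * n * (Q : ℝ)⁻¹ ^ (k + 2))) :=
            add_le_add h0 (mul_le_mul_of_nonneg_left h1 (by positivity))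
        _ = M * (Q + 1) ^ (n + 1) * (1 + 2 * n * (Q : ℝ)⁻¹ ^ (k + 1)) := by
            have : (Q : ℝ) * (Q : ℝ)⁻¹ = 1 := mul_inv_cancel₀ (by positivity)
            linear_combination (2 * n * M * (Q + 1) ^ n * (Q : ℝ)⁻¹ ^ k * ((Q : ℝ)⁻¹ - 1)) * this
        _ ≤ _ := by
            refine mul_le_mul_of_nonneg_left ?_ (by positivity)
            have : 0 ≤ (Q : ℝ)⁻¹ ^ (k + 1) := by positivity
            push_cast
            nlinarith

/-- The support of the orthogonality measure for `a = 2` lies to the right of `-1 / (b - 1)`. -/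
theorem functional_one_add_nonneg {Q : ℕ} (hQ : 1 ≤ Q) {g : ℝ[X] →ₗ[ℝ] ℝ}
    (hg : ∀ p, 0 ≤ g (p * p)) {M : ℝ} (hM : ∀ k, |g (gammaPoly 2 (Q + 1) k)| ≤ M) :
    0 ≤ g (1 + (Q : ℝ[X]) * X) := by
  set μ : ℝ[X] := 2 * (Q : ℝ[X]) * X - ((Q : ℝ[X]) - 1) with hμ
  have h1 : 0 ≤ g 1 := by simpa using hg 1
  -- The moments `g (μ ^ (2n))` are log-convex by Cauchy-Schwarz. The growth bound with exponent
  -- `2n` gives the factor `1 + 4n`, whence `g (μ²) ≤ (Q+1)² g 1`.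
  have key := le_of_logConvex (m := fun n => g (μ ^ n * μ ^ n)) (K := M) (R := (Q + 1 : ℝ) ^ 2)
    (by positivity) (fun n => hg _)
    (fun n => by
      have := sq_functional_mul_le hg (μ ^ n) (μ ^ (n + 2))
      convert this using 3
      ring)
    (fun n => by
      have := (le_abs_self _).trans (abs_functional_pow_mul_le hQ hM (2 * n) 0)
      rw [show gammaPoly 2 (Q + 1) 0 = 1 from rfl, mul_one, two_mul n, pow_add, ← hμ] at this
      refine this.trans (le_of_eq ?_)
      rw [← pow_mul, two_mul n]
      push_cast
      ring)
  simp only [pow_one, pow_zero, mul_one] at key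
  have h2 := sq_functional_mul_le hg 1 μ
  rw [one_mul, one_mul] at h2
  have h3 : |g μ| ≤ (Q + 1) * g 1 := by
    refine abs_le_of_sq_le_sq ?_ (by positivity)
    nlinarith [mul_le_mul_of_nonneg_left key h1]
  have h4 : (1 + (Q : ℝ[X]) * X) = (1 / 2 : ℝ) • (μ + (Q + 1 : ℝ) • 1) := by
    rw [hμ]
    simp only [smul_eq_C_mul, map_add, map_natCast, map_one]
    have : C (1 / 2 : ℝ) * 2 = 1 := by
      rw [← map_ofNat C 2, ← C_mul]; norm_num
    linear_combination (-(1 + (Q : ℝ[X]) * X)) * this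
  rw [h4, map_smul, map_add, map_smul, smul_eq_mul, smul_eq_mul]
  have := (abs_le.1 h3).1
  linarith

/-- The functional of a bounded positive definite function is nonnegative on the weighted squares
that certify positive semidefiniteness. -/
theorem IsGammaBlocks.functional_weighted_nonneg (h : IsGammaBlocks a b G C) (ha : 2 ≤ a)
    (hb : 2 ≤ b) {L : ℝ[X] →ₗ[ℝ] ℝ} (hL : ∀ p, 0 ≤ L (p * p)) {M : ℝ}
    (hM : ∀ k, |L (gammaPoly a b k)| ≤ M) (p : ℝ[X]) :
    (∀ k, 0 ≤ L ((1 - gammaPoly a b k) * (p * p))) ∧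
      ((a = 2 ∨ b = 2) → 0 ≤ L ((1 + ((b - 1 : ℕ) : ℝ[X]) * X) * (p * p))) := by
  -- Weighting by a square keeps positivity and boundedness, so the unweighted bounds for `g` are
  -- the desired weighted ones for `L`.
  let g : ℝ[X] →ₗ[ℝ] ℝ := L ∘ₗ LinearMap.mulLeft ℝ (p * p)
  have hgdef : ∀ q, g q = L (p * p * q) := fun q => rfl
  have hg : ∀ q, 0 ≤ g (q * q) := fun q => by
    rw [hgdef, show p * p * (q * q) = (p * q) * (p * q) by ring]; exact hL _
  obtain ⟨M', hM'⟩ := h.exists_bound_mul ha hb hM (p * p)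
  have hle := h.abs_functional_le ha hb hg hM'
  refine ⟨fun k => ?_, ?_⟩
  · rw [mul_comm, ← hgdef, map_sub]
    linarith [le_abs_self (g (gammaPoly a b k)), hle k]
  · rw [mul_comm, ← hgdef]
    rintro (rfl | rfl)
    · obtain ⟨Q, rfl⟩ : ∃ Q, b = Q + 1 := ⟨b - 1, by omega⟩
      exact functional_one_add_nonneg (by omega) hg hM'
    · have := (abs_le.1 (hle 1)).1
      rw [show gammaPoly a 2 1 = X from rfl] at this
      simp only [Nat.reduceSub, Nat.cast_one, one_mul, map_add]
      linarith

end Positive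

/-! ### The polynomial-valued Gram form. -/

section Form

variable {V : Type*}

/-- The `ℝ[X]`-bilinear form with kernel `P (d u v)`. -/
noncomputable def distForm (G : SimpleGraph V) (P : ℕ → ℝ[X]) :
    (V →₀ ℝ[X]) →ₗ[ℝ[X]] (V →₀ ℝ[X]) →ₗ[ℝ[X]] ℝ[X] :=
  Finsupp.linearCombination ℝ[X]
    (fun u => Finsupp.linearCombination ℝ[X] (fun v => P (G.dist u v)))

variable (G : SimpleGraph V) (P : ℕ → ℝ[X])

theorem distForm_single (u v : V) (r s : ℝ[X]) :
    distForm G P (Finsupp.single u r) (Finsupp.single v s) = r * s * P (G.dist u v) := by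
  simp [distForm, mul_assoc]

theorem distForm_eq_sum (c d : V →₀ ℝ[X]) :
    distForm G P c d = ∑ u ∈ c.support, c u * distForm G P (Finsupp.single u 1) d := by
  simp [distForm, Finsupp.linearCombination_apply, Finsupp.sum]

theorem distForm_comm (c d : V →₀ ℝ[X]) : distForm G P c d = distForm G P d c := by
  induction c using Finsupp.induction_linear with
  | zero => simp
  | add c c' h h' => simp [h, h']
  | single u r =>
    induction d using Finsupp.induction_linear with
    | zero => simp
    | add c c' h h' => simp only [map_add, LinearMap.add_apply, h, h']
    | single v s => rw [distForm_single, distForm_single, SimpleGraph.dist_comm, mul_comm r s]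

theorem distForm_eq_zero {c d : V →₀ ℝ[X]}
    (h : ∀ u ∈ c.support, distForm G P (Finsupp.single u 1) d = 0) : distForm G P c d = 0 := by
  rw [distForm_eq_sum]
  exact Finset.sum_eq_zero fun u hu => by rw [h u hu, mul_zero]

/-- Twice the variance is the sum of the squares `(t u - t v)²` over all ordered pairs. -/
theorem functional_variance_nonneg {L : ℝ[X] →ₗ[ℝ] ℝ} {α : ℝ[X]}
    (hα : ∀ p, 0 ≤ L (α * (p * p))) (s : Finset V) (t : V → ℝ[X]) :
    0 ≤ L (α * ((s.card : ℝ[X]) * ∑ u ∈ s, t u * t u - (∑ u ∈ s, t u) * ∑ u ∈ s, t u)) := by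
  have h : (2 : ℝ) • (α * ((s.card : ℝ[X]) * ∑ u ∈ s, t u * t u -
      (∑ u ∈ s, t u) * ∑ u ∈ s, t u)) =
      ∑ u ∈ s, ∑ v ∈ s, α * ((t u - t v) * (t u - t v)) := by
    have e : ∀ u v, α * ((t u - t v) * (t u - t v)) =
        α * (t u * t u) + α * (t v * t v) - 2 * α * (t u * t v) := fun u v => by ring
    simp only [e, Finset.sum_sub_distrib, Finset.sum_add_distrib, ← Finset.mul_sum,
      Finset.sum_const, ← Finset.sum_mul, nsmul_eq_mul, smul_eq_C_mul, map_ofNat]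
    have e2 : ∑ u ∈ s, t u * ((s.card : ℝ[X]) * t u) = (s.card : ℝ[X]) * ∑ u ∈ s, t u * t u := by
      rw [Finset.mul_sum]
      exact Finset.sum_congr rfl fun u _ => by ring
    rw [e2]
    ring
  have h2 : 0 ≤ L ((2 : ℝ) • (α * ((s.card : ℝ[X]) * ∑ u ∈ s, t u * t u -
      (∑ u ∈ s, t u) * ∑ u ∈ s, t u))) := by
    rw [h]
    simp only [map_sum]
    exact Finset.sum_nonneg fun u _ => Finset.sum_nonneg fun v _ => hα _
  rw [map_smul, smul_eq_mul] at h2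
  linarith

end Form

/-! ### Elimination of children and positivity of the form. -/

namespace IsGammaBlocks

variable {a b : ℕ} {V ι : Type*} {G : SimpleGraph V} {C : ι → Set V}

/-- The point `u` is `v`, or enters the block `C i` through a point other than `v`. -/
def OnSide (G : SimpleGraph V) (C : ι → Set V) (i : ι) (v u : V) : Prop :=
  u = v ∨ ∃ e ∈ C i, e ≠ v ∧ G.dist u v = G.dist u e + 1 ∧
    ∀ z ∈ C i, z ≠ e → G.dist u z = G.dist u v

theorem OnSide.of_mem (h : IsGammaBlocks a b G C) {i : ι} {v u : V} (hv : v ∈ C i)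
    (hu : u ∈ C i) : OnSide G C i v u := by
  by_cases huv : u = v
  · exact Or.inl huv
  · have hd : ∀ z ∈ C i, z ≠ u → G.dist u z = 1 := fun z hz hzu =>
      SimpleGraph.dist_eq_one_iff_adj.2 ((h.adj_iff _ _).2 ⟨hzu.symm, i, hu, hz⟩)
    have h1 := hd v hv (Ne.symm huv)
    refine Or.inr ⟨u, hu, huv, by rw [h1, SimpleGraph.dist_self], fun z hz hzu => ?_⟩
    rw [hd z hz hzu, h1]

theorem dist_child (h : IsGammaBlocks a b G C) {i : ι} {v u w : V} (hv : v ∈ C i)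
    (hu : OnSide G C i v u) (hw : G.Adj v w) (hwi : w ∉ C i) :
    G.dist u w = G.dist u v + 1 := by
  rcases hu with rfl | ⟨e, he, hev, hd, -⟩
  · simpa using SimpleGraph.dist_eq_one_iff_adj.2 hw
  · obtain ⟨j, hj, -, hfar⟩ := h.exists_block (x := u) (v := v) (by rintro rfl; simp at hd)
    have hij : i = j := by
      by_contra hij
      have := hfar i hv hij e he hev
      omega
    subst hij
    obtain ⟨hvw, k, hk, hwk⟩ := (h.adj_iff _ _).1 hw
    exact hfar k hk (by rintro rfl; exact hwi hwk) w hwk hvw.symm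

/-- The neighbours of `v` outside the block `C i`. -/
noncomputable def children (G : SimpleGraph V) (C : ι → Set V) (i : ι) (v : V) : Finset V :=
  finsetOf {w | G.Adj v w ∧ w ∉ C i}

theorem mem_children (h : IsGammaBlocks a b G C) (ha : 2 ≤ a) (hb : 2 ≤ b) {i : ι} {v w : V} :
    w ∈ children G C i v ↔ G.Adj v w ∧ w ∉ C i :=
  mem_finsetOf ((h.finite_neighborSet ha hb v).subset fun _ hw => hw.1)

theorem card_siblings [DecidableEq V] (h : IsGammaBlocks a b G C) (hb : 2 ≤ b) {i : ι} {v : V}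
    (hv : v ∈ C i) : ((finsetOf (C i)).erase v).card = b - 1 := by
  rw [Finset.card_erase_of_mem ((mem_finsetOf (h.finite_block hb i)).2 hv),
    card_finsetOf (h.finite_block hb i), h.ncard_block]

theorem card_children (h : IsGammaBlocks a b G C) (ha : 2 ≤ a) (hb : 2 ≤ b) {i : ι} {v : V}
    (hv : v ∈ C i) : (children G C i v).card = (a - 1) * (b - 1) := by
  classical
  have hS : (G.sphereFinset v 1).card = a * (b - 1) := by
    rw [h.card_sphereFinset ha hb]; simp [sphereSize, upDegree]
  have hsub : (finsetOf (C i)).erase v ⊆ G.sphereFinset v 1 := by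
    intro z hz
    rw [Finset.mem_erase, mem_finsetOf (h.finite_block hb i)] at hz
    rw [h.mem_sphereFinset ha hb, SimpleGraph.dist_eq_one_iff_adj, h.adj_iff]
    exact ⟨hz.1.symm, i, hv, hz.2⟩
  have hch : children G C i v = G.sphereFinset v 1 \ (finsetOf (C i)).erase v := by
    ext w
    rw [h.mem_children ha hb, Finset.mem_sdiff, h.mem_sphereFinset ha hb,
      SimpleGraph.dist_eq_one_iff_adj, Finset.mem_erase, mem_finsetOf (h.finite_block hb i)]
    constructor
    · exact fun hw => ⟨hw.1, fun hw' => hw.2 hw'.2⟩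
    · exact fun hw => ⟨hw.1, fun hw' => hw.2 ⟨hw.1.ne', hw'⟩⟩
  rw [hch, Finset.card_sdiff_of_subset hsub, hS, h.card_siblings hb hv, Nat.sub_mul, one_mul]

/-- Two children of the same point have a common distance if `a = 2` or `b = 2`. -/
theorem exists_dist_children (h : IsGammaBlocks a b G C) (ha : 2 ≤ a) (hb : 2 ≤ b)
    (hab : a = 2 ∨ b = 2) {i : ι} {v : V} (hv : v ∈ C i) :
    ∃ κ, (∀ w ∈ children G C i v, ∀ w' ∈ children G C i v, w ≠ w' → G.dist w w' = κ) ∧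
      ((a * (b - 1) : ℕ) : ℝ[X]) * X * gammaPoly a b 1 - ((b - 1 : ℕ) : ℝ[X]) * gammaPoly a b 2 =
        1 + ((((a - 1) * (b - 1) : ℕ) : ℝ[X]) - 1) * gammaPoly a b κ := by
  -- The identity for `κ` is the recurrence at distance `1`. It says that pairing a child with the
  -- mean `M` used below gives the average of its pairings with all children.
  have hrec := neighborSum_gammaPoly ha hb 1
  rw [show gammaPoly a b 1 = X from rfl] at *
  simp only [neighborSum, nsmul_eq_mul, show gammaPoly a b 0 = 1 from rfl, zero_add,
    show gammaPoly a b 1 = X from rfl] at hrec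
  rcases hab with rfl | rfl
  · refine ⟨1, fun w hw w' hw' hne => ?_, ?_⟩
    · rw [h.mem_children ha hb] at hw hw'
      obtain ⟨⟨hvw, j, hj, hwj⟩, hwi⟩ := And.imp_left (h.adj_iff _ _).1 hw
      obtain ⟨⟨hvw', k, hk, hwk⟩, hwi'⟩ := And.imp_left (h.adj_iff _ _).1 hw'
      have hij : i ≠ j := by rintro rfl; exact hwi hwj
      have hik : i ≠ k := by rintro rfl; exact hwi' hwk
      have hjk : j = k := by
        by_contra hjk
        have h1 : ({i, j, k} : Set ι).ncard = 3 := Set.ncard_eq_three.2 ⟨i, j, k, hij, hik, hjk, rfl⟩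
        have h2 := Set.ncard_le_ncard (s := {i, j, k}) (t := {i | v ∈ C i})
          (by rintro x (rfl | rfl | rfl) <;> assumption) (h.finite_at ha v)
        rw [h.ncard_at] at h2
        omega
      subst hjk
      exact SimpleGraph.dist_eq_one_iff_adj.2 ((h.adj_iff _ _).2 ⟨hne, j, hwj, hwk⟩)
    · rw [show gammaPoly 2 b 1 = X from rfl]
      obtain ⟨b, rfl⟩ := Nat.exists_eq_add_of_le hb
      have e1 : 2 + b - 1 = b + 1 := by omega
      have e2 : 2 + b - 2 = b := by omega
      simp only [e1, e2, Nat.reduceSub, one_mul] at hrec ⊢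
      push_cast at hrec ⊢
      linear_combination -hrec
  · refine ⟨2, fun w hw w' hw' hne => ?_, ?_⟩
    · rw [h.mem_children ha hb] at hw hw'
      obtain ⟨⟨hvw, j, hj, hwj⟩, hwi⟩ := And.imp_left (h.adj_iff _ _).1 hw
      obtain ⟨⟨hvw', k, hk, hwk⟩, hwi'⟩ := And.imp_left (h.adj_iff _ _).1 hw'
      refine h.dist_of_mem_block hj hk ?_ hwj hwk hvw.symm hvw'.symm
      rintro rfl
      have h1 : ({v, w, w'} : Set V).ncard = 3 :=
        Set.ncard_eq_three.2 ⟨v, w, w', hvw, hvw', hne, rfl⟩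
      have h2 := Set.ncard_le_ncard (s := {v, w, w'}) (t := C j)
        (by rintro x (rfl | rfl | rfl) <;> assumption) (h.finite_block hb j)
      rw [h.ncard_block] at h2
      omega
    · simp only [Nat.reduceSub, mul_one, Nat.sub_self, Nat.cast_zero, zero_mul, add_zero,
        Nat.cast_one, one_mul] at hrec ⊢
      linear_combination -hrec

/-- Eliminating the children of a point does not increase the form. -/
theorem exists_distForm_le (h : IsGammaBlocks a b G C) (ha : 2 ≤ a) (hb : 2 ≤ b)
    (hab : a = 2 ∨ b = 2) {L : ℝ[X] →ₗ[ℝ] ℝ}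
    (hL : ∀ k p, 0 ≤ L ((1 - gammaPoly a b k) * (p * p))) {i : ι} {v : V} (hv : v ∈ C i)
    (c : V →₀ ℝ[X]) (hc : ∀ u ∈ c.support, u ∈ children G C i v ∨ OnSide G C i v u) :
    ∃ c' : V →₀ ℝ[X], (∀ u ∈ c'.support, (u ∈ c.support ∧ u ∉ children G C i v) ∨ u ∈ C i) ∧
      L (distForm G (gammaPoly a b) c' c') ≤ L (distForm G (gammaPoly a b) c c) := by
  classical
  obtain ⟨κ, hκ, hid⟩ := h.exists_dist_children ha hb hab hv
  set B := distForm G (gammaPoly a b) with hB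
  set Ch := children G C i v with hCh
  set D := (finsetOf (C i)).erase v with hD
  set Q : ℕ := (a - 1) * (b - 1) with hQdef
  have hQ : (Q : ℝ) ≠ 0 := by
    exact_mod_cast (Nat.mul_pos (by omega) (by omega)).ne'
  have hCQ : Polynomial.C (Q : ℝ)⁻¹ * (Q : ℝ[X]) = 1 := by
    rw [← map_natCast Polynomial.C, ← C_mul, inv_mul_cancel₀ hQ, C_1]
  let e : V → V →₀ ℝ[X] := fun u => Finsupp.single u 1
  -- From `u` on the side of `C i`, the `Q` children of `v` are equidistant. Solving the neighbour
  -- recurrence at `v` for their common term gives `M`, which pairs with `e u` as each child does.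
  let M : V →₀ ℝ[X] := Polynomial.C (Q : ℝ)⁻¹ • ((((a * (b - 1) : ℕ) : ℝ[X]) * X) • e v - ∑ z ∈ D, e z)
  let η : V → V →₀ ℝ[X] := fun w => e w - M
  have memD : ∀ z, z ∈ D ↔ z ≠ v ∧ z ∈ C i := fun z => by
    rw [hD, Finset.mem_erase, mem_finsetOf (h.finite_block hb i)]
  have cardD : D.card = b - 1 := h.card_siblings hb hv
  have hBe : ∀ u z, B (e u) (e z) = gammaPoly a b (G.dist u z) := fun u z => by
    simp [hB, e, distForm_single]
  have hBM : ∀ u, B (e u) M = Polynomial.C (Q : ℝ)⁻¹ * (((a * (b - 1) : ℕ) : ℝ[X]) * X *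
      gammaPoly a b (G.dist u v) - ∑ z ∈ D, gammaPoly a b (G.dist u z)) := by
    intro u
    simp only [M, map_smul, map_sub, map_sum, hBe, smul_eq_mul]
  have horth : ∀ u, OnSide G C i v u → ∀ w ∈ Ch, B (e u) (η w) = 0 := by
    intro u hu w hw
    rw [hCh, h.mem_children ha hb] at hw
    rw [map_sub, hBe, h.dist_child hv hu hw.1 hw.2, hBM]
    rcases hu with rfl | ⟨f, hf, hfv, hd, hz⟩
    · have : ∑ z ∈ D, gammaPoly a b (G.dist u z) = ((b - 1 : ℕ) : ℝ[X]) * gammaPoly a b 1 := by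
        rw [Finset.sum_congr rfl (g := fun _ => gammaPoly a b 1), Finset.sum_const, cardD,
          nsmul_eq_mul]
        intro z hz
        rw [memD] at hz
        rw [SimpleGraph.dist_eq_one_iff_adj.2 ((h.adj_iff _ _).2 ⟨hz.1.symm, i, hv, hz.2⟩)]
      rw [this, SimpleGraph.dist_self, show gammaPoly a b 0 = 1 from rfl,
        show gammaPoly a b 1 = X from rfl]
      have hw : ((a * (b - 1) : ℕ) : ℝ[X]) = Q + (b - 1 : ℕ) := by
        rw [hQdef, ← Nat.cast_add, Nat.sub_mul, one_mul, Nat.sub_add_cancel]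
        exact Nat.le_mul_of_pos_left _ (by omega)
      rw [hw]
      linear_combination (-X) * hCQ
    · have hfD : f ∈ D := (memD f).2 ⟨hfv, hf⟩
      have : ∑ z ∈ D, gammaPoly a b (G.dist u z) = gammaPoly a b (G.dist u f) +
          ((b - 2 : ℕ) : ℝ[X]) * gammaPoly a b (G.dist u v) := by
        rw [← Finset.add_sum_erase _ _ hfD, Finset.sum_congr rfl
          (g := fun _ => gammaPoly a b (G.dist u v)), Finset.sum_const,
          Finset.card_erase_of_mem hfD, cardD, nsmul_eq_mul]
        · rfl
        · intro z hz'
          rw [Finset.mem_erase, memD] at hz'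
          rw [hz z hz'.2.2 hz'.1]
      rw [this, hd]
      have hrec := neighborSum_gammaPoly ha hb (G.dist u f + 1)
      simp only [neighborSum, nsmul_eq_mul, show gammaPoly a b 1 = X from rfl, ← hQdef] at hrec
      linear_combination Polynomial.C (Q : ℝ)⁻¹ * hrec - gammaPoly a b (G.dist u f + 2) * hCQ
  have hBMη : ∀ w ∈ Ch, B M (η w) = 0 := by
    intro w hw
    simp only [M, map_smul, map_sub, map_sum, LinearMap.smul_apply, LinearMap.sub_apply,
      LinearMap.sum_apply]
    rw [horth v (Or.inl rfl) w hw, Finset.sum_eq_zero]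
    · simp
    · intro z hz
      exact horth z (OnSide.of_mem h hv ((memD z).1 hz).2) w hw
  set c₀ := c.filter (· ∉ Ch) with hc₀
  set t := ∑ w ∈ Ch, c w with ht
  have hBc₀ : ∀ w ∈ Ch, B c₀ (η w) = 0 := by
    intro w hw
    refine distForm_eq_zero _ _ fun u hu => ?_
    rw [hc₀, Finsupp.support_filter, Finset.mem_filter] at hu
    exact horth u ((hc u hu.1).resolve_left hu.2) w hw
  -- The children's coefficients are moved onto `M`; the remaining noise is orthogonal to the first
  -- summand.
  have hdecomp : c = (c₀ + t • M) + ∑ w ∈ Ch, c w • η w := by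
    have h1 : ∑ w ∈ Ch, c w • η w = (∑ w ∈ Ch, c w • e w) - t • M := by
      simp only [η, smul_sub, Finset.sum_sub_distrib, ht, Finset.sum_smul]
    have h2 : c = c₀ + ∑ w ∈ Ch, c w • e w := by
      ext1 u
      simp only [hc₀, Finsupp.add_apply, Finsupp.filter_apply, Finsupp.finsetSum_apply,
        Finsupp.smul_apply, e, Finsupp.single_apply, smul_eq_mul, mul_ite, mul_one, mul_zero,
        Finset.sum_ite_eq']
      by_cases hu : u ∈ Ch <;> simp [hu]
    rw [h1, ← add_sub_assoc, add_right_comm, ← h2]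
    abel
  have hcross : B (c₀ + t • M) (∑ w ∈ Ch, c w • η w) = 0 := by
    rw [map_sum]
    refine Finset.sum_eq_zero fun w hw => ?_
    rw [map_smul, map_add, LinearMap.add_apply, map_smul, LinearMap.smul_apply, hBc₀ w hw,
      hBMη w hw]
    simp
  have hηη : ∀ w ∈ Ch, ∀ w' ∈ Ch, B (η w) (η w') =
      (1 - gammaPoly a b κ) * ((if w = w' then 1 else 0) - Polynomial.C (Q : ℝ)⁻¹) := by
    intro w hw w' hw'
    have h1 : B (η w) (η w') = B (e w) (e w') - B (e w) M := by
      have h2 : B (η w) (η w') = B (e w) (η w') - B M (η w') := by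
        simp only [η, map_sub, LinearMap.sub_apply]
        ring
      rw [h2, hBMη w' hw', sub_zero]
      exact map_sub _ _ _
    have hwc := (h.mem_children ha hb).1 hw
    have h2 : G.dist w v = 1 := SimpleGraph.dist_eq_one_iff_adj.2 hwc.1.symm
    have h3 : ∑ z ∈ D, gammaPoly a b (G.dist w z) = ((b - 1 : ℕ) : ℝ[X]) * gammaPoly a b 2 := by
      rw [Finset.sum_congr rfl (g := fun _ => gammaPoly a b 2), Finset.sum_const, cardD,
        nsmul_eq_mul]
      intro z hz
      rw [memD] at hz
      rw [SimpleGraph.dist_comm, h.dist_child hv (OnSide.of_mem h hv hz.2) hwc.1 hwc.2,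
        SimpleGraph.dist_eq_one_iff_adj.2 ((h.adj_iff _ _).2 ⟨hz.1, i, hz.2, hv⟩)]
    rw [h1, hBe, hBM, h2, h3, hid]
    by_cases hww : w = w'
    · subst hww
      rw [SimpleGraph.dist_self, if_pos rfl, show gammaPoly a b 0 = 1 from rfl]
      linear_combination (-gammaPoly a b κ) * hCQ
    · rw [hκ w hw w' hw' hww, if_neg hww]
      linear_combination (-gammaPoly a b κ) * hCQ
  have hnoise : 0 ≤ L (B (∑ w ∈ Ch, c w • η w) (∑ w ∈ Ch, c w • η w)) := by
    -- The covariance of the noise is `1 - P κ` times the centring projection; as there are exactly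
    -- `Q` children this is a variance.
    have h1 : B (∑ w ∈ Ch, c w • η w) (∑ w ∈ Ch, c w • η w) =
        (Q : ℝ)⁻¹ • ((1 - gammaPoly a b κ) * ((Ch.card : ℝ[X]) * ∑ u ∈ Ch, c u * c u -
          (∑ u ∈ Ch, c u) * ∑ u ∈ Ch, c u)) := by
      have h2 : B (∑ w ∈ Ch, c w • η w) (∑ w ∈ Ch, c w • η w) = ∑ w ∈ Ch, ∑ w' ∈ Ch,
          ((1 - gammaPoly a b κ) * ((if w = w' then c w * c w' else 0)) -
            (1 - gammaPoly a b κ) * Polynomial.C (Q : ℝ)⁻¹ * (c w * c w')) := by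
        rw [map_sum B, LinearMap.sum_apply]
        refine Finset.sum_congr rfl fun w hw => ?_
        rw [map_sum]
        refine Finset.sum_congr rfl fun w' hw' => ?_
        rw [map_smul B, LinearMap.smul_apply, map_smul, smul_eq_mul, smul_eq_mul,
          hηη w hw w' hw']
        split_ifs <;> ring
      rw [h2]
      simp only [Finset.sum_sub_distrib, ← Finset.mul_sum, ← Finset.sum_mul, Finset.sum_ite_eq]
      rw [Finset.sum_congr rfl (g := fun w => c w * c w) (fun w hw => if_pos hw), smul_eq_C_mul,
        hCh, h.card_children ha hb hv, ← hQdef]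
      linear_combination (-(1 - gammaPoly a b κ) * ∑ w ∈ children G C i v, c w * c w) * hCQ
    rw [h1, map_smul, smul_eq_mul]
    exact mul_nonneg (by positivity) (functional_variance_nonneg (hL κ) Ch c)
  refine ⟨c₀ + t • M, fun u hu => ?_, ?_⟩
  · by_contra hne
    push Not at hne
    rw [Finsupp.mem_support_iff] at hu
    apply hu
    have hM0 : M u = 0 := by
      have hv' : v ≠ u := by rintro rfl; exact hne.2 hv
      simp only [M, e, Finsupp.smul_apply, Finsupp.sub_apply, Finsupp.finsetSum_apply,
        Finsupp.single_apply, if_neg hv', smul_eq_mul, mul_zero, zero_sub]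
      rw [Finset.sum_eq_zero, neg_zero, mul_zero]
      intro z hz
      rw [if_neg]
      rintro rfl
      exact hne.2 ((memD z).1 hz).2
    rw [Finsupp.add_apply, Finsupp.smul_apply, hM0, smul_zero, add_zero, hc₀,
      Finsupp.filter_apply]
    split_ifs with h1
    · rfl
    · by_contra h2
      exact h1 (hne.1 (Finsupp.mem_support_iff.2 h2))
  · have hadd : ∀ A N, B A N = 0 → B (A + N) (A + N) = B A A + B N N := by
      intro A N hAN
      have hNA : B N A = 0 := by rw [hB, distForm_comm]; exact hAN
      simp only [map_add, LinearMap.add_apply, hAN, hNA]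
      ring
    have hsplit := hadd _ _ hcross
    rw [← hdecomp] at hsplit
    rw [hsplit, map_add L]
    linarith

/-- On a block the Gram matrix is `(1 - X) I + X J`. Multiplied by `b`, the form splits into a
variance with weight `1 - X` and the squared sum with weight `1 + (b-1)X`. -/
theorem distForm_nonneg_of_support_subset_block (h : IsGammaBlocks a b G C) (hb : 2 ≤ b)
    {L : ℝ[X] →ₗ[ℝ] ℝ} (hL : ∀ p, 0 ≤ L ((1 - X) * (p * p)))
    (hL' : ∀ p, 0 ≤ L ((1 + ((b - 1 : ℕ) : ℝ[X]) * X) * (p * p))) (i : ι) (c : V →₀ ℝ[X])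
    (hc : ∀ u ∈ c.support, u ∈ C i) : 0 ≤ L (distForm G (gammaPoly a b) c c) := by
  classical
  set s := finsetOf (C i) with hs
  have hcard : s.card = b := by rw [hs, card_finsetOf (h.finite_block hb i), h.ncard_block]
  have hmem : ∀ u, u ∈ s ↔ u ∈ C i := fun u => mem_finsetOf (h.finite_block hb i)
  have hsub : c.support ⊆ s := fun u hu => (hmem u).2 (hc u hu)
  have h1 : distForm G (gammaPoly a b) c c = ∑ u ∈ s, ∑ v ∈ s,
      ((1 - X) * (if u = v then c u * c v else 0) + X * (c u * c v)) := by
    have h2 : c = ∑ u ∈ s, Finsupp.single u (c u) := by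
      conv_lhs => rw [← Finsupp.sum_single c]
      exact Finsupp.sum_of_support_subset _ hsub _ (by simp)
    conv_lhs => rw [h2]
    simp only [map_sum, LinearMap.sum_apply, distForm_single]
    rw [Finset.sum_comm]
    refine Finset.sum_congr rfl fun u hu => Finset.sum_congr rfl fun v hv => ?_
    by_cases huv : u = v
    · subst huv
      rw [if_pos rfl, SimpleGraph.dist_self, show gammaPoly a b 0 = 1 from rfl]
      ring
    · rw [if_neg huv, SimpleGraph.dist_eq_one_iff_adj.2
        ((h.adj_iff _ _).2 ⟨huv, i, (hmem u).1 hu, (hmem v).1 hv⟩),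
        show gammaPoly a b 1 = X from rfl]
      ring
  have h3 : (b : ℝ) • distForm G (gammaPoly a b) c c =
      (1 - X) * ((s.card : ℝ[X]) * ∑ u ∈ s, c u * c u - (∑ u ∈ s, c u) * ∑ u ∈ s, c u) +
        (1 + ((b - 1 : ℕ) : ℝ[X]) * X) * ((∑ u ∈ s, c u) * ∑ u ∈ s, c u) := by
    rw [h1]
    simp only [Finset.sum_add_distrib, ← Finset.mul_sum, ← Finset.sum_mul, Finset.sum_ite_eq]
    rw [Finset.sum_congr rfl (g := fun w => c w * c w) (fun w hw => if_pos hw), smul_eq_C_mul,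
      hcard, map_natCast, Nat.cast_sub (by omega)]
    push_cast
    ring
  have h4 : 0 ≤ L ((b : ℝ) • distForm G (gammaPoly a b) c c) := by
    rw [h3, map_add]
    exact add_nonneg (functional_variance_nonneg hL s c) (hL' _)
  rw [map_smul, smul_eq_mul] at h4
  exact nonneg_of_mul_nonneg_right h4 (by exact_mod_cast (by omega : 0 < b))

theorem distForm_nonneg (h : IsGammaBlocks a b G C) (ha : 2 ≤ a) (hb : 2 ≤ b)
    (hab : a = 2 ∨ b = 2) {L : ℝ[X] →ₗ[ℝ] ℝ}
    (hL : ∀ k p, 0 ≤ L ((1 - gammaPoly a b k) * (p * p)))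
    (hL' : ∀ p, 0 ≤ L ((1 + ((b - 1 : ℕ) : ℝ[X]) * X) * (p * p))) (c : V →₀ ℝ[X]) :
    0 ≤ L (distForm G (gammaPoly a b) c c) := by
  classical
  obtain ⟨x⟩ := (h.connected (by omega)).nonempty
  obtain ⟨i₀, -⟩ := Set.nonempty_of_ncard_ne_zero (s := {i | x ∈ C i})
    (by rw [h.ncard_at]; omega)
  let depth : V → ℕ := fun u => (incidenceGraph C).dist (.inr i₀) (.inl u)
  -- Induction on the maximal depth outside `C i₀`, then on the number `m` of points of that depth.
  -- A peeling removes `w` and adds only shallower points, so `m` drops; at `n = 0` the support lies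
  -- in `C i₀`, since every point has positive depth.
  have key : ∀ n m (c : V →₀ ℝ[X]), (∀ u ∈ c.support, u ∉ C i₀ → depth u ≤ n) →
      (c.support.filter (fun u => u ∉ C i₀ ∧ depth u = n)).card = m →
      0 ≤ L (distForm G (gammaPoly a b) c c) := by
    intro n
    induction n with
    | zero =>
      intro m c hn _
      refine h.distForm_nonneg_of_support_subset_block hb (hL 1) hL' i₀ c fun u hu => ?_
      by_contra hui
      have h0 : (incidenceGraph C).dist (.inr i₀) (.inl u) ≤ 0 := hn u hu hui
      have := h.isTree.connected.pos_dist_of_ne (u := Sum.inr i₀) (v := Sum.inl u) (by simp)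
      omega
    | succ n ihn =>
      intro m
      induction m using Nat.strong_induction_on with
      | _ m ihm =>
        intro c hn hm
        by_cases hex : ∃ w ∈ c.support, w ∉ C i₀ ∧ depth w = n + 1
        · obtain ⟨w, hw, hwi, hwd⟩ := hex
          obtain ⟨i, v, hv, hwi', hvw, hlt, hside⟩ := h.exists_peel hwi
          have hwpos : ∀ u ∈ C i₀, depth u ≤ depth w := by
            intro u hu
            have h1 : depth u = 1 :=
              SimpleGraph.dist_eq_one_iff_adj.2 (adj_mk hu).symm
            omega
          obtain ⟨c', hsupp, hle⟩ := h.exists_distForm_le ha hb hab hL hv c (fun u hu => by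
            have hdu : depth u ≤ depth w := by
              by_cases hui : u ∈ C i₀
              · exact hwpos u hui
              · rw [hwd]; exact hn u hu hui
            rcases hside u hdu with h1 | h1
            · exact Or.inl ((h.mem_children ha hb).2 h1)
            · exact Or.inr h1)
          refine le_trans ?_ hle
          refine ihm _ ?_ c' ?_ rfl
          · rw [← hm]
            refine Finset.card_lt_card ⟨fun u hu => ?_, fun hsub => ?_⟩
            · rw [Finset.mem_filter] at hu ⊢
              rcases hsupp u hu.1 with h1 | h1
              · exact ⟨h1.1, hu.2⟩
              · have : depth u < depth w := hlt u h1
                omega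
            · have := hsub (Finset.mem_filter.2 ⟨hw, hwi, hwd⟩)
              rw [Finset.mem_filter] at this
              rcases hsupp w this.1 with h1 | h1
              · exact h1.2 ((h.mem_children ha hb).2 ⟨hvw, hwi'⟩)
              · exact hwi' h1
          · intro u hu hui
            rcases hsupp u hu with h1 | h1
            · exact hn u h1.1 hui
            · have : depth u < depth w := hlt u h1
              omega
        · push Not at hex
          refine ihn _ c (fun u hu hui => ?_) rfl
          have := hn u hu hui
          have := hex u hu hui
          omega
  exact key (c.support.sup depth) _ c (fun u hu _ => Finset.le_sup hu) rfl

end IsGammaBlocks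

/-! ### From functionals back to kernels. -/

theorem isPosSemidefKernel_of_real {S : Type*} {Q : S → S → ℝ} (hsymm : ∀ u v, Q u v = Q v u)
    (h : ∀ (n : ℕ) (x : Fin n → S) (s : Fin n → ℝ), 0 ≤ ∑ i, ∑ j, s i * s j * Q (x i) (x j)) :
    IsPosSemidefKernel (fun u v => (Q u v : ℂ)) := by
  intro n x c
  have hre := h n x (fun i => (c i).re)
  have him := h n x (fun i => (c i).im)
  have e1 : (∑ i, ∑ j, c i * (starRingEnd ℂ) (c j) * (Q (x i) (x j) : ℂ)).re =
      ∑ i, ∑ j, (c i).re * (c j).re * Q (x i) (x j) +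
        ∑ i, ∑ j, (c i).im * (c j).im * Q (x i) (x j) := by
    simp only [Complex.re_sum, ← Finset.sum_add_distrib]
    refine Finset.sum_congr rfl fun i _ => Finset.sum_congr rfl fun j _ => ?_
    simp
    ring
  have e2 : (∑ i, ∑ j, c i * (starRingEnd ℂ) (c j) * (Q (x i) (x j) : ℂ)).im = 0 := by
    have e3 : (∑ i, ∑ j, c i * (starRingEnd ℂ) (c j) * (Q (x i) (x j) : ℂ)).im =
        ∑ i, ∑ j, (c i).im * (c j).re * Q (x i) (x j) -
          ∑ i, ∑ j, (c i).re * (c j).im * Q (x i) (x j) := by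
      simp only [Complex.im_sum, ← Finset.sum_sub_distrib]
      refine Finset.sum_congr rfl fun i _ => Finset.sum_congr rfl fun j _ => ?_
      simp
      ring
    rw [e3, sub_eq_zero, Finset.sum_comm]
    refine Finset.sum_congr rfl fun i _ => Finset.sum_congr rfl fun j _ => ?_
    rw [hsymm]
    ring
  rw [Complex.le_def, e1, e2]
  exact ⟨add_nonneg hre him, rfl⟩

namespace IsGammaBlocks

variable {a b : ℕ} {V ι : Type*} {G : SimpleGraph V} {C : ι → Set V}

/-- The functional with moments `f` is positive if `f` is positive definite. -/
theorem functional_sq_nonneg (h : IsGammaBlocks a b G C) (ha : 2 ≤ a) (hb : 2 ≤ b) {f : ℕ → ℝ}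
    (hf : IsPosDefOnHypergroup G (fun k => (f k : ℂ))) {L : ℝ[X] →ₗ[ℝ] ℝ}
    (hLf : ∀ n, L (gammaPoly a b n) = f n) (p : ℝ[X]) : 0 ≤ L (p * p) := by
  have hp : p ∈ Submodule.span ℝ (Set.range (gammaPoly a b)) := by
    rw [span_gammaPoly ha hb]; trivial
  obtain ⟨c, rfl⟩ := (Finsupp.mem_span_range_iff_exists_finsupp).1 hp
  obtain ⟨N, hN⟩ := c.support.exists_nat_subset_range
  have hsum : (c.sum fun i r => r • gammaPoly a b i) =
      ∑ k : Fin N, c k • gammaPoly a b k := by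
    rw [Finsupp.sum_of_support_subset _ hN _ (by simp),
      Finset.sum_range (fun k => c k • gammaPoly a b k)]
  have hpos := hf N (fun k => k) (fun k => (c k : ℂ))
  simp only [convApply_ofReal, Complex.conj_ofReal] at hpos
  have hpos' : 0 ≤ ∑ k : Fin N, ∑ l : Fin N, c k * c l *
      ∑ m ∈ Finset.Icc (max (k : ℕ) l - min (k : ℕ) l) (k + l), convWeight G k l m * f m := by
    exact_mod_cast hpos
  convert hpos' using 1
  rw [hsum, Finset.sum_mul_sum, map_sum]
  refine Finset.sum_congr rfl fun k _ => ?_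
  rw [map_sum]
  refine Finset.sum_congr rfl fun l _ => ?_
  rw [smul_mul_smul_comm, map_smul, smul_eq_mul, h.gammaPoly_mul ha hb, map_sum]
  congr 1
  refine Finset.sum_congr rfl fun m _ => ?_
  rw [map_smul, smul_eq_mul, hLf]

theorem isPosSemidefKernel (h : IsGammaBlocks a b G C) (ha : 2 ≤ a) (hb : 2 ≤ b)
    (hab : a = 2 ∨ b = 2) {f : ℕ → ℝ} {M : ℝ} (hM : ∀ k, |f k| ≤ M)
    (hf : IsPosDefOnHypergroup G (fun k => (f k : ℂ))) :
    IsPosSemidefKernel (fun u v : V => (f (G.dist u v) : ℂ)) := by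
  obtain ⟨L, hLf⟩ := exists_functional ha hb f
  have hL := h.functional_weighted_nonneg ha hb (h.functional_sq_nonneg ha hb hf hLf)
    (M := M) (fun k => by rw [hLf]; exact hM k)
  refine isPosSemidefKernel_of_real (Q := fun u v => f (G.dist u v))
    (fun u v => by rw [SimpleGraph.dist_comm]) fun n x s => ?_
  -- On constant coefficients, `L` of the Gram form is the quadratic form of the kernel.
  have key := h.distForm_nonneg ha hb hab (L := L) (fun k p => (hL p).1 k)
    (fun p => (hL p).2 hab) (∑ i, Finsupp.single (x i) (Polynomial.C (s i)))
  convert key using 1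
  simp only [map_sum, LinearMap.sum_apply, distForm_single]
  rw [Finset.sum_comm]
  refine Finset.sum_congr rfl fun i _ => Finset.sum_congr rfl fun j _ => ?_
  rw [← C_mul, ← smul_eq_C_mul, map_smul, hLf, smul_eq_mul]

/-! ### The counterexample for `a, b ≥ 3`. -/

/-- Multiplicativity turns the double sum into the squared modulus of `∑ k, c k * φ (x k)`. -/
theorem isPosDefOnHypergroup_of_eigen (h : IsGammaBlocks a b G C) (ha : 2 ≤ a) (hb : 2 ≤ b)
    {φ : ℕ → ℝ} (h0 : φ 0 = 1)
    (hφ : ∀ n, neighborSum a b φ n = (a * (b - 1) : ℕ) • (φ 1 * φ n)) :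
    IsPosDefOnHypergroup G (fun k => (φ k : ℂ)) := by
  intro n x c
  have e : ∑ k, ∑ l, c k * (starRingEnd ℂ) (c l) * convApply G (fun k => (φ k : ℂ)) (x k) (x l) =
      (∑ k, c k * φ (x k)) * (starRingEnd ℂ) (∑ k, c k * φ (x k)) := by
    rw [map_sum, Finset.sum_mul_sum]
    refine Finset.sum_congr rfl fun k _ => Finset.sum_congr rfl fun l _ => ?_
    rw [convApply_ofReal]
    have := h.mul_eq_sum_convWeight ha hb φ h0 hφ (x k) (x l)
    simp only [smul_eq_mul] at this
    rw [← this, map_mul, Complex.conj_ofReal]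
    push_cast
    ring
  rw [e, Complex.mul_conj]
  exact_mod_cast Complex.normSq_nonneg _

/-- The spherical function of least eigenvalue among the bounded ones. -/
theorem exists_extremal_eigen (ha : 3 ≤ a) (hb : 3 ≤ b) :
    ∃ φ : ℕ → ℝ, φ 0 = 1 ∧ (∀ n, neighborSum a b φ n = (a * (b - 1) : ℕ) • (φ 1 * φ n)) ∧
      (∃ M, ∀ k, |φ k| ≤ M) ∧ 1 + ((b - 1 : ℕ) : ℝ) * φ 1 < 0 := by
  obtain ⟨a, rfl⟩ := Nat.exists_eq_add_of_le ha
  obtain ⟨b, rfl⟩ := Nat.exists_eq_add_of_le hb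
  have e1 : 3 + b - 1 = b + 2 := by omega
  have e2 : 3 + b - 2 = b + 1 := by omega
  have e3 : 3 + a - 1 = a + 2 := by omega
  set Q : ℝ := (a + 2) * (b + 2) with hQ
  set w : ℝ := (a + 3) * (b + 2) with hw
  have hA : (0 : ℝ) ≤ a := a.cast_nonneg
  have hB : (0 : ℝ) ≤ b := b.cast_nonneg
  have hQ1 : 1 < Q := by nlinarith
  have hw0 : 0 < w := by positivity
  -- From here on `a` and `b` are the original parameters minus `3`. The eigenvalue `lam` is chosen
  -- so that `-1` is a root of `1 + (b+1)z + Qz² = w lam z`; the product of the roots is `1/Q`, so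
  -- the other is `q = -1/Q`. The weight `r` is fixed by `φ 1 = lam`.
  set lam : ℝ := -((a + 1) * (b + 2) + 2) / w with hlam
  set q : ℝ := -Q⁻¹ with hq
  have hqQ : Q * q = -1 := by rw [hq]; field_simp
  set r : ℝ := (-lam + q) / (1 + q) with hr
  have hq1 : 0 < 1 + q := by
    have := inv_lt_one_of_one_lt₀ hQ1
    rw [hq]; linarith
  have hr' : r * (1 + q) = -lam + q := by rw [hr]; field_simp
  have hlam' : w * lam = -((a + 1) * (b + 2) + 2) := by rw [hlam]; field_simp
  have hφ1 : r * (-1) ^ 1 + (1 - r) * q ^ 1 = lam := by linear_combination -hr'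
  have root1 : 1 + (b + 1) * (-1) + Q * (-1) ^ 2 = w * lam * (-1) := by
    rw [hlam', hQ]; ring
  have root2 : 1 + (b + 1) * q + Q * q ^ 2 = w * lam * q := by
    rw [hlam']
    have : Q * q ^ 2 = -q := by linear_combination q * hqQ
    rw [this]
    linear_combination hqQ - q * hQ
  refine ⟨fun n => r * (-1) ^ n + (1 - r) * q ^ n, by simp, fun n => ?_,
    ⟨|r| + |1 - r|, fun k => ?_⟩, ?_⟩
  · simp only [hφ1]
    cases n with
    | zero =>
      simp only [neighborSum, hφ1]
      simp
    | succ n =>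
      simp only [neighborSum, e1, e2, e3, nsmul_eq_mul]
      push_cast
      linear_combination (r * (-1) ^ n) * root1 + ((1 - r) * q ^ n) * root2
  · have hq' : |q| ≤ 1 := by
      rw [hq, abs_neg, abs_of_nonneg (by positivity)]
      exact (inv_lt_one_of_one_lt₀ hQ1).le
    calc _ ≤ |r * (-1) ^ k| + |(1 - r) * q ^ k| := abs_add_le _ _
      _ = |r| + |1 - r| * |q| ^ k := by simp [abs_mul, abs_pow]
      _ ≤ |r| + |1 - r| * 1 := by
          gcongr
          exact pow_le_one₀ (abs_nonneg q) hq'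
      _ = _ := by rw [mul_one]
  · simp only [hφ1, e1]
    rw [hlam, hw]
    push_cast
    -- In the original parameters this value is `-(a-2)(b-2)/a`, negative because both exceed `2`.
    have : (1 : ℝ) + (b + 2) * (-((a + 1) * (b + 2) + 2) / ((a + 3) * (b + 2))) =
        -((a + 1) * (b + 1)) / (a + 3) := by
      field_simp
      ring
    rw [this]
    apply div_neg_of_neg_of_pos _ (by positivity)
    have : 0 < ((a : ℝ) + 1) * (b + 1) := by positivity
    linarith

/-- Testing the kernel on the all-ones vector of a block gives `b` equal row sums. -/
theorem kernel_block_nonneg (h : IsGammaBlocks a b G C) (hb : 2 ≤ b) {φ : ℕ → ℝ}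
    (h0 : φ 0 = 1) (hφ : IsPosSemidefKernel (fun u v : V => (φ (G.dist u v) : ℂ))) (i : ι) :
    0 ≤ 1 + ((b - 1 : ℕ) : ℝ) * φ 1 := by
  have hcard : (finsetOf (C i)).card = b := by
    rw [card_finsetOf (h.finite_block hb i), h.ncard_block]
  let x : Fin b → V := fun k => ((finsetOf (C i)).equivFinOfCardEq hcard).symm k
  have hxinj : Function.Injective x := fun k l hkl =>
    ((finsetOf (C i)).equivFinOfCardEq hcard).symm.injective (Subtype.ext hkl)
  have hxmem : ∀ k, x k ∈ C i := fun k => (mem_finsetOf (h.finite_block hb i)).1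
    (((finsetOf (C i)).equivFinOfCardEq hcard).symm k).2
  have hpos := hφ b x (fun _ => 1)
  simp only [map_one, mul_one, one_mul] at hpos
  have hpos' : 0 ≤ ∑ k, ∑ l, φ (G.dist (x k) (x l)) := by exact_mod_cast hpos
  have e : ∀ k, ∑ l, φ (G.dist (x k) (x l)) = 1 + ((b - 1 : ℕ) : ℝ) * φ 1 := by
    intro k
    rw [← Finset.add_sum_erase _ _ (Finset.mem_univ k), SimpleGraph.dist_self, h0,
      Finset.sum_congr rfl (g := fun _ => φ 1), Finset.sum_const,
      Finset.card_erase_of_mem (Finset.mem_univ k), Finset.card_univ, Fintype.card_fin,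
      nsmul_eq_mul]
    intro l hl
    rw [SimpleGraph.dist_eq_one_iff_adj.2 ((h.adj_iff _ _).2
      ⟨fun hkl => (Finset.ne_of_mem_erase hl) (hxinj hkl).symm, i, hxmem k, hxmem l⟩)]
  simp only [e, Finset.sum_const, Finset.card_univ, Fintype.card_fin, nsmul_eq_mul] at hpos'
  exact nonneg_of_mul_nonneg_right hpos' (by exact_mod_cast (by omega : 0 < b))

end IsGammaBlocks

theorem corollary7p2 {V : Type*} (a b : ℕ) (ha : 2 ≤ a) (hb : 2 ≤ b)
    (G : SimpleGraph V) (hG : IsGamma a b G) :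
    IsDistanceRegular G ∧ (∀ k : ℕ, ∃ u v : V, G.dist u v = k) ∧
    ((a = 2 ∨ b = 2) ↔
      ∀ f : ℕ → ℝ, (∃ M : ℝ, ∀ k, |f k| ≤ M) →
        IsPosDefOnHypergroup G (fun k => (f k : ℂ)) →
        IsPosSemidefKernel (fun u v : V => (f (G.dist u v) : ℂ))) := by
  obtain ⟨ι, C, h1, h2, h3, h4⟩ := hG
  have h : IsGammaBlocks a b G C := ⟨h1, h2, h3, h4⟩
  obtain ⟨x⟩ := (h.connected (by omega)).nonempty
  refine ⟨h.isDistanceRegular ha hb, fun k => ⟨x, h.exists_dist_eq ha hb x k⟩,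
    fun hab f ⟨M, hM⟩ hf => h.isPosSemidefKernel ha hb hab hM hf, fun H => ?_⟩
  by_contra! hne
  obtain ⟨φ, h0, hφ, hbd, hneg⟩ := exists_extremal_eigen (a := a) (b := b) (by omega) (by omega)
  obtain ⟨i, -⟩ := Set.nonempty_of_ncard_ne_zero (s := {i | x ∈ C i})
    (by rw [h.ncard_at]; omega)
  have := h.kernel_block_nonneg hb h0 (H φ hbd (h.isPosDefOnHypergroup_of_eigen ha hb h0 hφ)) i
  linarith
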